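/- For $a>0$ let $\mathcal F_+f(y)=\int_{\mathbb R}\cos(2\pi xy)f(x)\,dx$ be the cosine transform, let $P_a$ be the restriction to $[-a,a]$ (multiplication by the indicator function), and let $F_a^+=P_a\mathcal F_+P_a$, i.e. the integral operator on $L^2(-a,a;dx)$ with kernel $\cos(2\pi xy)$. Let $D_a^+$ be the operator on $L^2(0,1;dx)$ whose kernel is the even Dirichlet kernel at $s=2\pi a^2$, $$\frac{\sin(s(x-y))}{\pi(x-y)}+\frac{\sin(s(x+y))}{\pi(x+y)}$$ (extended by continuity). Fredholm determinants are given by Fredholm's series $$\det(1+K)=\sum_{n\ge0}\frac1{n!}\int\!\cdots\!\int\det\big(K(x_i,x_j)\big)_{1\le i,j\le n}\,dx_1\cdots dx_n.$$ For every $a>0$ there are unique locally integrable real functions $\phi_a^+$ and $\phi_a^-$ on $\mathbb R$ which satisfy, for all $x\in\mathbb R$, $$\phi_a^+(x)+(\mathcal F_+P_a\phi_a^+)(x)=2\cos(2\pi ax),\qquad \phi_a^-(x)-(\mathcal F_+P_a\phi_a^-)(x)=2\cos(2\pi ax).$$ For $u\in\mathbb R$ and $a=e^u$ put $d_+(u)=\det(1-D_a^+)$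 and $\mu_+(u)=a\,\phi_a^+(a)+a\,\phi_a^-(a)$. Then $\det(1-D_a^+)$, $\det(1+F_a^+)$ and $\det(1-F_a^+)$ are positive, their logarithms are twice continuously differentiable functions of $u$, $\mu_+$ is differentiable, and for all $u\in\mathbb R$ $$\mu_+(u)^2=-\frac{d^2}{du^2}\log d_+(u),$$ $$\mu_+(u)^2-\mu_+'(u)=-2\frac{d^2}{du^2}\log\det(1+F_a^+),$$ $$\mu_+(u)^2+\mu_+'(u)=-2\frac{d^2}{du^2}\log\det(1-F_a^+).$$ -/

import Mathlib

open MeasureTheory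

noncomputable section

/-- The Fredholm determinant `det (1 + K)` of the integral operator on `L²(μ)` with kernel `K`,
given by Fredholm's series
`∑ₙ (1 / n!) ∫ ⋯ ∫ det (K (xᵢ, xⱼ))_{1 ≤ i, j ≤ n} dμ(x₁) ⋯ dμ(xₙ)`. -/
def fredholmDet (μ : Measure ℝ) (K : ℝ → ℝ → ℝ) : ℝ :=
  ∑' n : ℕ, (1 / (Nat.factorial n : ℝ)) *
    ∫ x : Fin n → ℝ, (Matrix.of fun i j : Fin n => K (x i) (x j)).det ∂(Measure.pi fun _ => μ)

/-- The cosine transform `ℱ₊`. -/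
def cosTransform (f : ℝ → ℝ) (y : ℝ) : ℝ :=
  ∫ x, Real.cos (2 * Real.pi * x * y) * f x

/-- The restriction operator `P_a` to the interval `[-a, a]`. -/
def restrictTo (a : ℝ) (f : ℝ → ℝ) : ℝ → ℝ :=
  (Set.Icc (-a) a).indicator f

/-- The truncated cosine transform `F_a⁺ = P_a ℱ₊ P_a`. -/
def truncCosTransform (a : ℝ) (f : ℝ → ℝ) : ℝ → ℝ :=
  restrictTo a (cosTransform (restrictTo a f))

/-- The kernel of `F_a⁺`, viewed as an operator on `L²(-a, a; dx)`. -/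
def truncCosKernel (x y : ℝ) : ℝ :=
  Real.cos (2 * Real.pi * x * y)

/-- On `[-a, a]`, the operator `F_a⁺ = P_a ℱ₊ P_a` is the integral operator with kernel
`truncCosKernel`. -/
theorem truncCosTransform_eq_integral (a : ℝ) (f : ℝ → ℝ) {x : ℝ} (hx : x ∈ Set.Icc (-a) a) :
    truncCosTransform a f x = ∫ y in Set.Icc (-a) a, truncCosKernel x y * f y := by
  unfold truncCosTransform restrictTo
  rw [Set.indicator_of_mem hx, cosTransform, ← integral_indicator measurableSet_Icc]
  congr 1
  funext y
  by_cases hy : y ∈ Set.Icc (-a) a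
  · simp only [Set.indicator_of_mem hy, truncCosKernel]
    congr 2
    ring
  · simp [Set.indicator_of_notMem hy]

/-- `det (1 + F_a⁺)`. -/
def detOneAddF (a : ℝ) : ℝ :=
  fredholmDet (volume.restrict (Set.Icc (-a) a)) truncCosKernel

/-- `det (1 - F_a⁺)`. -/
def detOneSubF (a : ℝ) : ℝ :=
  fredholmDet (volume.restrict (Set.Icc (-a) a)) (fun x y => -truncCosKernel x y)

/-- The even Dirichlet kernel
`sin (s (x - y)) / (π (x - y)) + sin (s (x + y)) / (π (x + y))`,
with the continuous value `s / π` of a term whose denominator vanishes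
(`Real.sinc t = sin t / t` for `t ≠ 0` and `Real.sinc 0 = 1`). -/
def evenDirichletKernel (s x y : ℝ) : ℝ :=
  s / Real.pi * Real.sinc (s * (x - y)) + s / Real.pi * Real.sinc (s * (x + y))

theorem evenDirichletKernel_eq {s x y : ℝ} (hs : s ≠ 0) (h₁ : x - y ≠ 0) (h₂ : x + y ≠ 0) :
    evenDirichletKernel s x y =
      Real.sin (s * (x - y)) / (Real.pi * (x - y)) +
        Real.sin (s * (x + y)) / (Real.pi * (x + y)) := by
  unfold evenDirichletKernel
  rw [Real.sinc_of_ne_zero (mul_ne_zero hs h₁), Real.sinc_of_ne_zero (mul_ne_zero hs h₂)]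
  field_simp

/-- After rescaling to `(0, 1)`, `F_a⁺` has the kernel `2 a cos (2 π a² x y)`; the kernel of its
square `D_a⁺ = (F_a⁺)²` is the even Dirichlet kernel at `s = 2 π a²`. -/
theorem integral_cos_mul_cos_eq_evenDirichletKernel (a x y : ℝ) :
    ∫ z in (0 : ℝ)..1, (2 * a * Real.cos (2 * Real.pi * a ^ 2 * x * z)) *
        (2 * a * Real.cos (2 * Real.pi * a ^ 2 * z * y)) =
      evenDirichletKernel (2 * Real.pi * a ^ 2) x y := by
  have key : ∀ c : ℝ, ∫ z in (0 : ℝ)..1, Real.cos (c * z) = Real.sinc c := by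
    intro c
    by_cases hc : c = 0
    · simp [hc]
    · rw [intervalIntegral.integral_comp_mul_left _ hc, Real.sinc_of_ne_zero hc]
      simp [div_eq_inv_mul]
  set s := 2 * Real.pi * a ^ 2 with hs
  have h1 : ∀ z : ℝ, (2 * a * Real.cos (s * x * z)) * (2 * a * Real.cos (s * z * y)) =
      s / Real.pi * Real.cos (s * (x - y) * z) + s / Real.pi * Real.cos (s * (x + y) * z) := by
    intro z
    have e1 : s * (x - y) * z = s * x * z - s * z * y := by ring
    have e2 : s * (x + y) * z = s * x * z + s * z * y := by ring
    have e3 : s / Real.pi = 2 * a ^ 2 := by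
      rw [hs]; field_simp
    rw [e1, e2, e3, Real.cos_sub, Real.cos_add]
    ring
  simp only [h1]
  rw [intervalIntegral.integral_add, intervalIntegral.integral_const_mul,
    intervalIntegral.integral_const_mul, key, key, evenDirichletKernel]
  all_goals
    apply Continuous.intervalIntegrable
    fun_prop

/-- `d_a⁺ = det (1 - D_a⁺)`, where `D_a⁺` is the operator on `L²(0, 1; dx)` whose kernel is the
even Dirichlet kernel at `s = 2 π a²`. -/
def detOneSubD (a : ℝ) : ℝ :=
  fredholmDet (volume.restrict (Set.Ioo 0 1))
    (fun x y => -evenDirichletKernel (2 * Real.pi * a ^ 2) x y)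

/-- `φ` is a locally integrable solution of `φ + ε ℱ₊ P_a φ = 2 cos (2 π a x)`, `x ∈ ℝ`.
The function `φ_a⁺` is the solution for `ε = 1` and `φ_a⁻` is the solution for `ε = -1`. -/
def IsPhi (ε a : ℝ) (φ : ℝ → ℝ) : Prop :=
  LocallyIntegrable φ ∧
    ∀ x : ℝ, φ x + ε * cosTransform (restrictTo a φ) x = 2 * Real.cos (2 * Real.pi * a * x)

/-- `μ₊(u) = a φ_a⁺(a) + a φ_a⁻(a)` with `a = exp u`, for families `φp a = φ_a⁺`,
`φm a = φ_a⁻`. -/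
def muPlus (φp φm : ℝ → ℝ → ℝ) (u : ℝ) : ℝ :=
  Real.exp u * φp (Real.exp u) (Real.exp u) + Real.exp u * φm (Real.exp u) (Real.exp u)

end

/-! Put a = exp u and rescale to [0, 1]. The kernel cos (2πxy) is even, so the determinants of 1 ±
F_a⁺ are those of 1 ± K, where K acts on C([0, 1]) with kernel 2a cos (2πa²xy), and D_a⁺ becomes K².
Let k = K(·, 1), (1 + K) p = k and (1 - K) q = k. Then p(x) = a φ⁺(ax) and q(x) = a φ⁻(ax) on [0,
1], so μ = p(1) + q(1).

K depends only on the product xy, so its derivative in u is the generator 2x∂ₓ + 1 of dilations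
applied to K in either variable. Three facts carry the proof. The diagonal of the logarithmic
derivative of det (1 ± K) is an exact derivative in x, so (log det (1 + K))' = p(1) and (log det (1
- K))' = -q(1) (`hasDerivAt_det_cosKernel`). The derivative of D is 2 k ⊗ k, so (log det (1 - D))' =
p(1) - q(1) (`hasDerivAt_det_dirichletKernel`). Integration by parts, with its boundary term at 1,
gives the Riccati equation (p - q)' = -(p(1) + q(1))(p + q) (`deriv_cosSol_sub`). At x = 1 this
reads (p(1) - q(1))' = -μ², and the three identities follow.

The analytic support is as follows. Hadamard's bound allows Fredholm's series to be differentiated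
term by term, and the first minor is the determinant times (1 + K)⁻¹K (`fderiv_det_apply`). The
operators 1 ± K are invertible by the Fredholm alternative: a kernel element extends to φ = ±ℱ₊P_aφ
on ℝ, Plancherel forces φ = 0 outside [-a, a], and φ is the restriction of an entire function
(`eq_zero_of_eq_cosTransform`). Each determinant solves a linear equation D' = D g and tends to 1 as
u → -∞, hence is positive. -/

noncomputable section

namespace Fredholm

/-! ### Hadamard's inequality and the convergence of Fredholm's series. -/

section Hadamard

/-- **Hadamard's inequality**. -/
theorem abs_det_le_prod_norm {n : ℕ} (A : Matrix (Fin n) (Fin n) ℝ) :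
    |A.det| ≤ ∏ i, ‖(WithLp.toLp 2 (A i) : EuclideanSpace ℝ (Fin n))‖ := by
  have : Fact (Module.finrank ℝ (EuclideanSpace ℝ (Fin n)) = n) := ⟨by simp⟩
  set b := EuclideanSpace.basisFun (Fin n) ℝ
  have h := b.toBasis.orientation.abs_volumeForm_apply_le
    (fun i => (WithLp.toLp 2 (A i) : EuclideanSpace ℝ (Fin n)))
  rw [Orientation.volumeForm_robust _ b rfl, Module.Basis.det_apply] at h
  convert h using 2
  rw [← Matrix.det_transpose]
  congr 1

/-- A row with entries at most c i has Euclidean norm at most √n * c i. One bound per row is kept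
because `detForm` takes its rows from different kernels. -/
theorem abs_det_le_of_abs_le {n : ℕ} (A : Matrix (Fin n) (Fin n) ℝ) (c : Fin n → ℝ)
    (hA : ∀ i j, |A i j| ≤ c i) : |A.det| ≤ √n ^ n * ∏ i, c i := by
  refine (abs_det_le_prod_norm A).trans ?_
  calc ∏ i, ‖(WithLp.toLp 2 (A i) : EuclideanSpace ℝ (Fin n))‖ ≤ ∏ i, (√n * c i) := by
        refine Finset.prod_le_prod (fun i _ => norm_nonneg _) fun i _ => ?_
        have hc : 0 ≤ c i := (abs_nonneg _).trans (hA i i)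
        rw [EuclideanSpace.norm_eq, ← Real.sqrt_sq hc, ← Real.sqrt_mul (Nat.cast_nonneg n)]
        refine Real.sqrt_le_sqrt ?_
        calc ∑ j, ‖A i j‖ ^ 2 ≤ ∑ _j : Fin n, c i ^ 2 :=
              Finset.sum_le_sum fun j _ => by
                rw [Real.norm_eq_abs]; exact pow_le_pow_left₀ (abs_nonneg _) (hA i j) 2
          _ = n * c i ^ 2 := by simp
    _ = √n ^ n * ∏ i, c i := by rw [Finset.prod_mul_distrib]; simp

/-- The bounds from Hadamard's inequality are summable, even with a polynomial weight. -/
theorem summable_hadamard (C : ℝ) (hC : 0 ≤ C) :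
    Summable fun n : ℕ => ((n : ℝ) + 1) * (1 / (n.factorial : ℝ)) *
      (√((n : ℝ) + 1) ^ (n + 1) * C ^ n) := by
  -- The terms are compared with M / 2 ^ n. Squaring removes the roots; (n + 1) ^ (n + 1) ≤ e ^ (n +
  -- 1) * (n + 1)! leaves powers over n!, and 32 is 4 (from the squared 2 ^ n) times 8 (from (n + 1)
  -- ^ 3 ≤ 8 ^ n).
  set M := √(Real.exp 1 * Real.exp (32 * Real.exp 1 * C ^ 2))
  refine Summable.of_nonneg_of_le (fun n => by positivity) (fun n => ?_)
    ((summable_geometric_of_lt_one (r := (1 / 2 : ℝ)) (by norm_num) (by norm_num)).mul_left M)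
  have hf : (0 : ℝ) < n.factorial := by exact_mod_cast n.factorial_pos
  have h1 : ((n : ℝ) + 1) ^ (n + 1) ≤ Real.exp 1 ^ (n + 1) * ((n + 1) * n.factorial) := by
    have := Real.pow_div_factorial_le_exp ((n : ℝ) + 1) (by positivity) (n + 1)
    rw [div_le_iff₀ (by positivity), Nat.factorial_succ] at this
    rw [← Real.exp_nat_mul]
    push_cast at this ⊢
    simpa using this
  have h2 : ((n : ℝ) + 1) ≤ 2 ^ n := by exact_mod_cast Nat.lt_two_pow_self
  have h3 := Real.pow_div_factorial_le_exp (32 * Real.exp 1 * C ^ 2) (by positivity) n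
  rw [one_div_pow, mul_one_div M, le_div_iff₀ (by positivity)]
  refine Real.le_sqrt_of_sq_le ?_
  have h4 : (√((n : ℝ) + 1) ^ (n + 1)) ^ 2 = ((n : ℝ) + 1) ^ (n + 1) := by
    rw [← pow_mul, mul_comm, pow_mul, Real.sq_sqrt (by positivity)]
  have h5 : ((n : ℝ) + 1) ^ 3 ≤ 8 ^ n := by
    calc ((n : ℝ) + 1) ^ 3 ≤ (2 ^ n) ^ 3 := by gcongr
      _ = 8 ^ n := by rw [← pow_mul, mul_comm, pow_mul]; norm_num
  calc (((n : ℝ) + 1) * (1 / (n.factorial : ℝ)) * (√((n : ℝ) + 1) ^ (n + 1) * C ^ n) * 2 ^ n) ^ 2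
      = ((n : ℝ) + 1) ^ 2 / (n.factorial : ℝ) ^ 2 * ((n : ℝ) + 1) ^ (n + 1) * (C ^ n * 2 ^ n) ^ 2 := by
        rw [← h4]; ring
    _ ≤ ((n : ℝ) + 1) ^ 2 / (n.factorial : ℝ) ^ 2 *
        (Real.exp 1 ^ (n + 1) * ((n + 1) * n.factorial)) * (C ^ n * 2 ^ n) ^ 2 := by gcongr
    _ = Real.exp 1 * (((n : ℝ) + 1) ^ 3 * ((4 * Real.exp 1 * C ^ 2) ^ n / n.factorial)) := by
        have : (4 : ℝ) ^ n = (2 ^ n) ^ 2 := by rw [← pow_mul, mul_comm, pow_mul]; norm_num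
        rw [mul_pow (4 * Real.exp 1), mul_pow 4, mul_pow (C ^ n), this]
        field_simp
        ring
    _ ≤ Real.exp 1 * (8 ^ n * ((4 * Real.exp 1 * C ^ 2) ^ n / n.factorial)) := by gcongr
    _ = Real.exp 1 * ((32 * Real.exp 1 * C ^ 2) ^ n / n.factorial) := by
        rw [← mul_div_assoc, ← mul_pow]
        ring_nf
    _ ≤ Real.exp 1 * Real.exp (32 * Real.exp 1 * C ^ 2) := by gcongr

end Hadamard

/-! ### Row expansion of determinants under the integral sign. -/

theorem continuous_cons {X : Type*} [TopologicalSpace X] {n : ℕ} (t : X) (j : Fin (n + 1)) :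
    Continuous fun x : Fin n → X => (Fin.cons t x : Fin (n + 1) → X) j := by
  refine Fin.cases ?_ (fun i => ?_) j
  · simpa using continuous_const
  · simpa using continuous_apply i

theorem cons_insertNth {X : Type*} {n : ℕ} (t z : X) (x : Fin n → X) (k : Fin (n + 1)) (j : Fin (n + 1)) :
    (Fin.cons t (k.insertNth z x : Fin (n + 1) → X) : Fin (n + 2) → X) (k.succ.succAbove j) =
      (Fin.cons t x : Fin (n + 1) → X) j := by
  refine Fin.cases ?_ (fun i => ?_) j
  · simp
  · simp [Fin.succ_succAbove_succ]

/-- Bringing z from position k to the front is a cycle of length k + 1, of sign (-1) ^ k. This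
cancels the alternating sign of the cofactors. -/
theorem det_insertNth_rows {X : Type*} (K : X × X → ℝ) {n : ℕ} (t z : X) (x : Fin n → X) (k : Fin (n + 1)) :
    (Matrix.of fun i j : Fin (n + 1) =>
      K ((k.insertNth z x : Fin (n + 1) → X) i, (Fin.cons t x : Fin (n + 1) → X) j)).det =
    (-1) ^ (k : ℕ) * (Matrix.of fun i j : Fin (n + 1) =>
      K ((Fin.cons z x : Fin (n + 1) → X) i, (Fin.cons t x : Fin (n + 1) → X) j)).det := by
  have h := Matrix.det_permute k.cycleRange (Matrix.of fun i j : Fin (n + 1) =>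
      K ((Fin.cons z x : Fin (n + 1) → X) i, (Fin.cons t x : Fin (n + 1) → X) j))
  rw [Fin.sign_cycleRange] at h
  push_cast at h
  rw [← h]
  congr 1
  ext i j
  simp only [Matrix.of_apply, Matrix.submatrix_apply, id]
  congr 2
  rw [← Fin.insertNth_apply_cycleRange_symm, Equiv.symm_apply_apply]

variable {X : Type*} [TopologicalSpace X] [CompactSpace X] [SecondCountableTopology X]
  [MeasurableSpace X] [BorelSpace X]

theorem integrable_of_continuous {Y : Type*} [TopologicalSpace Y] [CompactSpace Y]
    [MeasurableSpace Y] [BorelSpace Y] (ν : Measure Y) [IsFiniteMeasure ν] {f : Y → ℝ}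
    (hf : Continuous f) : Integrable f ν :=
  (BoundedContinuousFunction.mkOfCompact (⟨f, hf⟩ : C(Y, ℝ))).integrable ν

theorem integral_pi_succ (μ : Measure X) [IsProbabilityMeasure μ] {n : ℕ} (k : Fin (n + 1))
    (F : (Fin (n + 1) → X) → ℝ) (hF : Continuous F) :
    ∫ x, F x ∂(Measure.pi fun _ => μ) =
      ∫ z, ∫ x : Fin n → X, F (k.insertNth z x) ∂(Measure.pi fun _ => μ) ∂μ := by
  have h := (measurePreserving_piFinSuccAbove (fun _ : Fin (n + 1) => μ) k).symm.integral_comp' F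
  rw [← h, integral_prod]
  · rfl
  · refine integrable_of_continuous _ (hF.comp ?_)
    exact continuous_pi fun j => by
      refine Fin.succAboveCases k ?_ (fun i => ?_) j
      · simpa [MeasurableEquiv.piFinSuccAbove_symm_apply] using continuous_fst
      · simpa [MeasurableEquiv.piFinSuccAbove_symm_apply, Function.comp_def] using
          (continuous_apply i).comp continuous_snd

variable (μ : Measure X) [IsProbabilityMeasure μ]

/-- The integral `∫ ⋯ ∫ det (K (xᵢ, xⱼ))_{1 ≤ i, j ≤ n}`. -/
def detIntegral (K : C(X × X, ℝ)) (n : ℕ) : ℝ :=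
  ∫ x : Fin n → X, (Matrix.of fun i j : Fin n => K (x i, x j)).det ∂(Measure.pi fun _ => μ)

/-- The terms of Fredholm's first minor. -/
def minorIntegral (K : C(X × X, ℝ)) (n : ℕ) (s t : X) : ℝ :=
  ∫ x : Fin n → X, (Matrix.of fun i j : Fin (n + 1) =>
    K ((Fin.cons s x : Fin (n + 1) → X) i, (Fin.cons t x : Fin (n + 1) → X) j)).det
      ∂(Measure.pi fun _ => μ)

/-- Expansion of a determinant with an exceptional first row, integrated over all but one of the
variables. -/
theorem integral_det_cons_row (K : C(X × X, ℝ)) (g : C(X, ℝ)) (t : X) (n : ℕ) :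
    ∫ x : Fin (n + 1) → X, (Matrix.of (Fin.cons (fun j => g ((Fin.cons t x : Fin (n + 2) → X) j))
        (fun i j => K (x i, (Fin.cons t x : Fin (n + 2) → X) j)) :
          Fin (n + 2) → Fin (n + 2) → ℝ)).det ∂(Measure.pi fun _ => μ) =
      g t * detIntegral μ K (n + 1) - (n + 1) * ∫ z, g z * minorIntegral μ K n z t ∂μ := by
  have hc : ∀ k : Fin (n + 1), Continuous fun x : Fin (n + 1) → X =>
      (-1) ^ ((k : ℕ) + 1) * g (x k) * (Matrix.of fun i j : Fin (n + 1) =>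
        K (x i, (Fin.cons t x : Fin (n + 2) → X) (k.succ.succAbove j))).det := by
    intro k
    refine Continuous.mul (by fun_prop) (Continuous.matrix_det ?_)
    refine continuous_matrix fun i j => ?_
    exact K.continuous.comp ((continuous_apply i).prodMk (continuous_cons t _))
  -- All cofactors off the first column have the same integral: x k is renamed z and moved to the
  -- front, and the two signs multiply to -1.
  have hk : ∀ k : Fin (n + 1), ∫ x : Fin (n + 1) → X,
      (-1) ^ ((k : ℕ) + 1) * g (x k) * (Matrix.of fun i j : Fin (n + 1) =>
        K (x i, (Fin.cons t x : Fin (n + 2) → X) (k.succ.succAbove j))).det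
          ∂(Measure.pi fun _ => μ) = -∫ z, g z * minorIntegral μ K n z t ∂μ := by
    intro k
    rw [integral_pi_succ μ k _ (hc k), ← integral_neg]
    congr 1
    funext z
    rw [minorIntegral, ← integral_const_mul, ← integral_neg]
    congr 1
    funext x
    simp only [Fin.insertNth_apply_same, cons_insertNth, det_insertNth_rows]
    rw [pow_succ]
    have : ((-1 : ℝ) ^ (k : ℕ)) * (-1) ^ (k : ℕ) = 1 := by
      rw [← mul_pow]; simp
    linear_combination (-g z * (Matrix.of fun i j : Fin (n + 1) =>
      K ((Fin.cons z x : Fin (n + 1) → X) i, (Fin.cons t x : Fin (n + 1) → X) j)).det) * this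
  have hexp : ∀ x : Fin (n + 1) → X,
      (Matrix.of (Fin.cons (fun j => g ((Fin.cons t x : Fin (n + 2) → X) j))
        (fun i j => K (x i, (Fin.cons t x : Fin (n + 2) → X) j)) :
          Fin (n + 2) → Fin (n + 2) → ℝ)).det =
      g t * (Matrix.of fun i j : Fin (n + 1) => K (x i, x j)).det +
      ∑ k : Fin (n + 1), (-1) ^ ((k : ℕ) + 1) * g (x k) * (Matrix.of fun i j : Fin (n + 1) =>
        K (x i, (Fin.cons t x : Fin (n + 2) → X) (k.succ.succAbove j))).det := by
    intro x
    rw [Matrix.det_succ_row_zero, Fin.sum_univ_succ]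
    congr 1
    · simp only [Matrix.of_apply, Fin.cons_zero, Fin.val_zero, pow_zero, one_mul]
      congr 2
  simp_rw [hexp]
  rw [integral_add, integral_finsetSum]
  · simp_rw [hk]
    rw [integral_const_mul, detIntegral]
    simp
    ring
  · exact fun k _ => integrable_of_continuous _ (hc k)
  · refine integrable_of_continuous _ (continuous_const.mul (Continuous.matrix_det ?_))
    refine continuous_matrix fun i j => ?_
    exact K.continuous.comp ((continuous_apply i).prodMk (continuous_apply j))
  · exact integrable_of_continuous _ (continuous_finsetSum _ fun k _ => hc k)

end Fredholm
end

noncomputable section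

namespace Fredholm

set_option linter.unusedSectionVars false

variable {X : Type*} [TopologicalSpace X] [CompactSpace X] [SecondCountableTopology X]
  [MeasurableSpace X] [BorelSpace X] (μ : Measure X) [IsProbabilityMeasure μ]

/-! ### Integral operators on continuous functions. -/

section Operators

/-- Integration as a continuous linear functional on continuous functions. -/
def integralCLM : C(X, ℝ) →L[ℝ] ℝ :=
  LinearMap.mkContinuous
    { toFun := fun f => ∫ x, f x ∂μ
      map_add' := fun f g =>
        integral_add (integrable_of_continuous μ f.continuous)
          (integrable_of_continuous μ g.continuous)
      map_smul' := fun c f => integral_const_mul c f } 1 fun f => by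
    have := norm_integral_le_of_norm_le_const (μ := μ)
      (Filter.Eventually.of_forall fun x => f.norm_coe_le_norm x)
    simpa using this

@[simp]
theorem integralCLM_apply (f : C(X, ℝ)) : integralCLM μ f = ∫ x, f x ∂μ := rfl

theorem norm_integralCLM_le (f : C(X, ℝ)) : ‖integralCLM μ f‖ ≤ ‖f‖ := by
  simpa using (integralCLM μ).le_of_opNorm_le (LinearMap.mkContinuous_norm_le _ zero_le_one _) f

/-- The integral operator with a given continuous kernel. -/
def integralOp : C(X × X, ℝ) →L[ℝ] C(X, ℝ) →L[ℝ] C(X, ℝ) :=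
  LinearMap.mkContinuous₂ (LinearMap.mk₂ ℝ
    (fun K f => (⟨fun s => integralCLM μ (K.curry s * f), by fun_prop⟩ : C(X, ℝ)))
    (fun K L f => by
      ext s
      have : (K + L).curry s * f = K.curry s * f + L.curry s * f := by ext; simp [add_mul]
      simp only [ContinuousMap.coe_mk, this, map_add]; rfl)
    (fun c K f => by
      ext s
      have : (c • K).curry s * f = c • (K.curry s * f) := by ext; simp
      simp only [ContinuousMap.coe_mk, this, map_smul]; rfl)
    (fun K f g => by
      ext s
      simp only [ContinuousMap.coe_mk, mul_add, map_add]; rfl)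
    (fun c K f => by
      ext s
      simp only [ContinuousMap.coe_mk, mul_smul_comm, map_smul]; rfl)) 1 fun K f => by
    rw [one_mul, ContinuousMap.norm_le _ (by positivity)]
    intro s
    refine (norm_integralCLM_le μ _).trans ((norm_mul_le _ _).trans ?_)
    gcongr
    rw [ContinuousMap.norm_le _ (by positivity)]
    exact fun z => K.norm_coe_le_norm (s, z)

theorem integralOp_apply (K : C(X × X, ℝ)) (f : C(X, ℝ)) (s : X) :
    integralOp μ K f s = ∫ z, K (s, z) * f z ∂μ := rfl

/-- The column `K (·, t)` of a kernel. -/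
def column (K : C(X × X, ℝ)) : C(X, C(X, ℝ)) := (K.comp ContinuousMap.prodSwap).curry

omit [CompactSpace X] [SecondCountableTopology X] [MeasurableSpace X] [BorelSpace X] in
@[simp]
theorem column_apply (K : C(X × X, ℝ)) (s t : X) : column K t s = K (s, t) := rfl

end Operators

/-! ### Fredholm's terms as bounded multilinear forms, and the first minors. -/

section Form

theorem continuous_det_kernel {Y : Type*} [TopologicalSpace Y] {n : ℕ}
    (Ks : Fin n → C(Y × Y, ℝ)) :
    Continuous fun x : Fin n → Y => (Matrix.of fun i j : Fin n => Ks i (x i, x j)).det := by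
  refine Continuous.matrix_det (continuous_matrix fun i j => ?_)
  exact (Ks i).continuous.comp ((continuous_apply i).prodMk (continuous_apply j))

/-- The `n`-linear form whose diagonal values are `∫ ⋯ ∫ det (K (xᵢ, xⱼ))`: the `i`-th row of the
determinant uses the `i`-th kernel. -/
def detForm (n : ℕ) : ContinuousMultilinearMap ℝ (fun _ : Fin n => C(X × X, ℝ)) ℝ :=
  MultilinearMap.mkContinuous
    { toFun := fun Ks => ∫ x : Fin n → X, (Matrix.of fun i j : Fin n => Ks i (x i, x j)).det
        ∂(Measure.pi fun _ => μ)
      map_update_add' := fun {inst} Ks i A B => by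
        obtain rfl : inst = instDecidableEqFin n := Subsingleton.elim _ _
        rw [← integral_add (integrable_of_continuous _ (continuous_det_kernel _))
          (integrable_of_continuous _ (continuous_det_kernel _))]
        congr 1
        funext x
        have h : ∀ C : C(X × X, ℝ),
            (Matrix.of fun i' j : Fin n => Function.update Ks i C i' (x i', x j)) =
            (Matrix.of fun i' j : Fin n => Ks i' (x i', x j)).updateRow i
              fun j => C (x i, x j) := by
          intro C
          ext i' j
          by_cases hi : i' = i
          · subst hi; simp
          · simp [hi]
        rw [h, h, h, ← Matrix.det_updateRow_add]
        rfl
      map_update_smul' := fun {inst} Ks i c A => by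
        obtain rfl : inst = instDecidableEqFin n := Subsingleton.elim _ _
        rw [smul_eq_mul, ← integral_const_mul]
        congr 1
        funext x
        have h : ∀ C : C(X × X, ℝ),
            (Matrix.of fun i' j : Fin n => Function.update Ks i C i' (x i', x j)) =
            (Matrix.of fun i' j : Fin n => Ks i' (x i', x j)).updateRow i
              fun j => C (x i, x j) := by
          intro C
          ext i' j
          by_cases hi : i' = i
          · subst hi; simp
          · simp [hi]
        rw [h, h, ← Matrix.det_updateRow_smul]
        rfl } (√n ^ n) fun Ks => by
    have := norm_integral_le_of_norm_le_const (μ := Measure.pi fun _ : Fin n => μ)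
      (f := fun x : Fin n → X => (Matrix.of fun i j : Fin n => Ks i (x i, x j)).det)
      (Filter.Eventually.of_forall fun x => abs_det_le_of_abs_le _ (fun i => ‖Ks i‖)
        fun i j => (Ks i).norm_coe_le_norm _)
    simpa using this

theorem detForm_apply {n : ℕ} (Ks : Fin n → C(X × X, ℝ)) :
    detForm μ n Ks = ∫ x : Fin n → X, (Matrix.of fun i j : Fin n => Ks i (x i, x j)).det
        ∂(Measure.pi fun _ => μ) := rfl

theorem norm_detForm_apply_le {n : ℕ} (Ks : Fin n → C(X × X, ℝ)) :
    ‖detForm μ n Ks‖ ≤ √n ^ n * ∏ i, ‖Ks i‖ :=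
  (detForm μ n).le_of_opNorm_le (MultilinearMap.mkContinuous_norm_le _ (by positivity) _) Ks

theorem detForm_const (K : C(X × X, ℝ)) (n : ℕ) :
    detForm μ n (fun _ => K) = detIntegral μ K n := rfl

theorem detIntegral_zero (K : C(X × X, ℝ)) : detIntegral μ K 0 = 1 := by
  simp [detIntegral]

theorem minorIntegral_zero (K : C(X × X, ℝ)) (s t : X) : minorIntegral μ K 0 s t = K (s, t) := by
  simp [minorIntegral]

/-- Fredholm's recursion: `integral_det_cons_row` with g = K (s, ·). -/
theorem minorIntegral_succ (K : C(X × X, ℝ)) (n : ℕ) (s t : X) :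
    minorIntegral μ K (n + 1) s t = K (s, t) * detIntegral μ K (n + 1) -
      (n + 1) * ∫ z, K (s, z) * minorIntegral μ K n z t ∂μ := by
  have h := integral_det_cons_row μ K (K.curry s) t n
  simp only [ContinuousMap.curry_apply] at h
  rw [← h, minorIntegral]
  congr 1
  funext x
  congr 1
  ext i j
  refine Fin.cases ?_ (fun i => ?_) i <;> simp

theorem abs_minorIntegrand_le (K : C(X × X, ℝ)) {n : ℕ} (s t : X) (x : Fin n → X) :
    ‖(Matrix.of fun i j : Fin (n + 1) =>
      K ((Fin.cons s x : Fin (n + 1) → X) i, (Fin.cons t x : Fin (n + 1) → X) j)).det‖ ≤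
      √(n + 1) ^ (n + 1) * ‖K‖ ^ (n + 1) := by
  simpa using abs_det_le_of_abs_le (Matrix.of fun i j : Fin (n + 1) =>
      K ((Fin.cons s x : Fin (n + 1) → X) i, (Fin.cons t x : Fin (n + 1) → X) j)) (fun _ => ‖K‖)
    fun i j => K.norm_coe_le_norm _

theorem norm_minorIntegral_le (K : C(X × X, ℝ)) (n : ℕ) (s t : X) :
    ‖minorIntegral μ K n s t‖ ≤ √(n + 1) ^ (n + 1) * ‖K‖ ^ (n + 1) := by
  simpa [minorIntegral] using norm_integral_le_of_norm_le_const (μ := Measure.pi fun _ : Fin n => μ)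
    (Filter.Eventually.of_forall fun x => abs_minorIntegrand_le K s t x)

theorem continuous_minorIntegral (K : C(X × X, ℝ)) (n : ℕ) :
    Continuous fun p : X × X => minorIntegral μ K n p.1 p.2 := by
  have hc : ∀ j : Fin (n + 1), Continuous fun q : X × (Fin n → X) =>
      (Fin.cons q.1 q.2 : Fin (n + 1) → X) j := by
    intro j
    refine Fin.cases ?_ (fun i => ?_) j
    · simpa using continuous_fst
    · simpa [Function.comp_def] using (continuous_apply i).comp continuous_snd
  have hF : Continuous fun q : (X × X) × (Fin n → X) => (Matrix.of fun i j : Fin (n + 1) =>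
      K ((Fin.cons q.1.1 q.2 : Fin (n + 1) → X) i, (Fin.cons q.1.2 q.2 : Fin (n + 1) → X) j)).det := by
    refine Continuous.matrix_det (continuous_matrix fun i j => K.continuous.comp ?_)
    exact ((hc i).comp ((continuous_fst.comp continuous_fst).prodMk continuous_snd)).prodMk
      ((hc j).comp ((continuous_snd.comp continuous_fst).prodMk continuous_snd))
  refine continuous_of_dominated (bound := fun _ => √(n + 1) ^ (n + 1) * ‖K‖ ^ (n + 1))
    (fun p => (hF.comp (Continuous.prodMk_right p)).aestronglyMeasurable)
    (fun p => Filter.Eventually.of_forall fun x => abs_minorIntegrand_le K p.1 p.2 x)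
    (integrable_const _) (Filter.Eventually.of_forall fun x => ?_)
  exact hF.comp (Continuous.prodMk_left x)

/-- The exceptional row is brought to the front together with its variable. Rows and columns undergo
the same permutation, so no sign appears and the value does not depend on i. -/
theorem detForm_update (K H : C(X × X, ℝ)) (n : ℕ) (i : Fin (n + 1)) :
    detForm μ (n + 1) (Function.update (fun _ => K) i H) =
      ∫ t, ∫ x : Fin n → X, (Matrix.of (Fin.cons
        (fun j => H (t, (Fin.cons t x : Fin (n + 1) → X) j))
        (fun i j => K (x i, (Fin.cons t x : Fin (n + 1) → X) j)) :
          Fin (n + 1) → Fin (n + 1) → ℝ)).det ∂(Measure.pi fun _ => μ) ∂μ := by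
  rw [detForm_apply, integral_pi_succ μ i _ (continuous_det_kernel _)]
  congr 1
  funext t
  congr 1
  funext x
  rw [← Matrix.det_submatrix_equiv_self i.cycleRange.symm]
  congr 1
  ext i' j'
  simp only [Matrix.submatrix_apply, Matrix.of_apply, Fin.insertNth_apply_cycleRange_symm]
  refine Fin.cases ?_ (fun i' => ?_) i'
  · simp
  · simp

end Form
end Fredholm
end

/-! ### The Fredholm determinant and its derivative. -/

noncomputable section

namespace Fredholm

set_option linter.unusedSectionVars false

variable {X : Type*} [TopologicalSpace X] [CompactSpace X] [SecondCountableTopology X]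
  [MeasurableSpace X] [BorelSpace X] (μ : Measure X) [IsProbabilityMeasure μ]

/-- The Fredholm determinant `det (1 + K)` on a compact space. -/
def det (K : C(X × X, ℝ)) : ℝ := ∑' n : ℕ, 1 / (n.factorial : ℝ) * detIntegral μ K n

/-- The normalized terms of the first minor, as continuous kernels. -/
def minorTerm (K : C(X × X, ℝ)) (n : ℕ) : C(X × X, ℝ) :=
  ⟨fun p => 1 / (n.factorial : ℝ) * minorIntegral μ K n p.1 p.2,
    continuous_const.mul (continuous_minorIntegral μ K n)⟩

theorem norm_minorTerm_le (K : C(X × X, ℝ)) (n : ℕ) :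
    ‖minorTerm μ K n‖ ≤
      ‖K‖ * (((n : ℝ) + 1) * (1 / (n.factorial : ℝ)) * (√((n : ℝ) + 1) ^ (n + 1) * ‖K‖ ^ n)) := by
  rw [ContinuousMap.norm_le _ (by positivity)]
  intro p
  have h := norm_minorIntegral_le μ K n p.1 p.2
  calc ‖minorTerm μ K n p‖ = 1 / (n.factorial : ℝ) * ‖minorIntegral μ K n p.1 p.2‖ := by
        simp [minorTerm]
    _ ≤ 1 * (1 / (n.factorial : ℝ)) * (√(n + 1) ^ (n + 1) * ‖K‖ ^ (n + 1)) := by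
        rw [one_mul]; gcongr
    _ ≤ (n + 1) * (1 / (n.factorial : ℝ)) * (√(n + 1) ^ (n + 1) * ‖K‖ ^ (n + 1)) := by
        gcongr; simp
    _ = _ := by ring

theorem summable_norm_minorTerm (K : C(X × X, ℝ)) : Summable fun n => ‖minorTerm μ K n‖ :=
  Summable.of_nonneg_of_le (fun _ => norm_nonneg _) (norm_minorTerm_le μ K)
    ((summable_hadamard _ (norm_nonneg K)).mul_left _)

theorem sqrt_pow_le (n : ℕ) : √(n : ℝ) ^ n ≤ √((n : ℝ) + 1) ^ (n + 1) := by
  have h1 : (1 : ℝ) ≤ √((n : ℝ) + 1) := by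
    rw [Real.one_le_sqrt]; linarith [n.cast_nonneg (α := ℝ)]
  calc √(n : ℝ) ^ n ≤ √((n : ℝ) + 1) ^ n := by gcongr; linarith
    _ ≤ √((n : ℝ) + 1) ^ (n + 1) := pow_le_pow_right₀ h1 (Nat.le_succ n)

theorem summable_det (K : C(X × X, ℝ)) :
    Summable fun n : ℕ => 1 / (n.factorial : ℝ) * detIntegral μ K n := by
  refine Summable.of_norm_bounded (summable_hadamard _ (norm_nonneg K)) fun n => ?_
  have h := norm_detForm_apply_le μ (fun _ : Fin n => K)
  rw [detForm_const] at h
  simp only [Finset.prod_const, Finset.card_univ, Fintype.card_fin] at h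
  calc ‖1 / (n.factorial : ℝ) * detIntegral μ K n‖
      = 1 / (n.factorial : ℝ) * ‖detIntegral μ K n‖ := by simp
    _ ≤ 1 * (1 / (n.factorial : ℝ)) * (√((n : ℝ) + 1) ^ (n + 1) * ‖K‖ ^ n) := by
        rw [one_mul]
        gcongr
        exact h.trans (by gcongr; exact sqrt_pow_le n)
    _ ≤ _ := by gcongr; simp

/-- The derivative of the `n`-th term of Fredholm's series. -/
def termDeriv (K : C(X × X, ℝ)) (n : ℕ) : C(X × X, ℝ) →L[ℝ] ℝ :=
  (1 / (n.factorial : ℝ)) • ((detForm μ n).linearDeriv fun _ => K).comp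
    (ContinuousLinearMap.pi fun _ => ContinuousLinearMap.id ℝ _)

theorem hasFDerivAt_term (K : C(X × X, ℝ)) (n : ℕ) :
    HasFDerivAt (fun K => 1 / (n.factorial : ℝ) * detIntegral μ K n) (termDeriv μ K n) K := by
  have h := (detForm μ n).hasFDerivAt (x := fun _ => K)
  exact (h.comp K (ContinuousLinearMap.hasFDerivAt
    (ContinuousLinearMap.pi fun _ : Fin n => ContinuousLinearMap.id ℝ C(X × X, ℝ)))).const_mul _

theorem termDeriv_apply (K H : C(X × X, ℝ)) (n : ℕ) :
    termDeriv μ K n H =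
      1 / (n.factorial : ℝ) * ∑ i, detForm μ n (Function.update (fun _ => K) i H) := by
  simp [termDeriv, ContinuousMultilinearMap.linearDeriv_apply]

/-- Each of the n + 1 rows is replaced once by H; this is the source of the weight n + 1 in
`summable_hadamard`. -/
theorem norm_termDeriv_succ_le (K : C(X × X, ℝ)) (n : ℕ) :
    ‖termDeriv μ K (n + 1)‖ ≤
      ((n : ℝ) + 1) * (1 / (n.factorial : ℝ)) * (√((n : ℝ) + 1) ^ (n + 1) * ‖K‖ ^ n) := by
  refine ContinuousLinearMap.opNorm_le_bound _ (by positivity) fun H => ?_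
  rw [termDeriv_apply]
  have h : ∀ i : Fin (n + 1), ‖detForm μ (n + 1) (Function.update (fun _ => K) i H)‖ ≤
      √((n : ℝ) + 1) ^ (n + 1) * (‖K‖ ^ n * ‖H‖) := by
    intro i
    refine (norm_detForm_apply_le μ _).trans ?_
    push_cast
    gcongr
    rw [Fin.prod_univ_succAbove _ i]
    simp [mul_comm]
  have hs := norm_sum_le_of_le Finset.univ fun i _ => h i
  have h1 : (1 / ((n + 1).factorial : ℝ)) ≤ 1 / (n.factorial : ℝ) := by
    gcongr
    exact Nat.le_succ n
  calc _ = 1 / ((n + 1).factorial : ℝ) *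
        ‖∑ i, detForm μ (n + 1) (Function.update (fun _ => K) i H)‖ := by
        rw [norm_mul]; congr 1; simp
    _ ≤ 1 / (n.factorial : ℝ) *
        ∑ _i : Fin (n + 1), √((n : ℝ) + 1) ^ (n + 1) * (‖K‖ ^ n * ‖H‖) := by gcongr
    _ = _ := by simp; ring

theorem termDeriv_zero (K : C(X × X, ℝ)) : termDeriv μ K 0 = 0 := by
  ext H; simp [termDeriv_apply]

/-- Termwise differentiation is justified on the ball of radius ‖K‖ + 1, where the derivatives have
a common summable bound. -/
theorem hasFDerivAt_det (K : C(X × X, ℝ)) :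
    HasFDerivAt (det μ) (∑' n, termDeriv μ K n) K := by
  set R := ‖K‖ + 1
  -- The bound for term n + 1 carries index n. At n = 0 the truncated subtraction gives a harmless
  -- value, since that term has derivative zero.
  have hu : Summable fun n : ℕ => (((n - 1 : ℕ) : ℝ) + 1) * (1 / ((n - 1).factorial : ℝ)) *
      (√(((n - 1 : ℕ) : ℝ) + 1) ^ ((n - 1) + 1) * R ^ (n - 1)) :=
    (summable_nat_add_iff 1).mp (summable_hadamard R (by positivity))
  have hK : K ∈ Metric.ball (0 : C(X × X, ℝ)) R := by simp [R]
  refine hasFDerivAt_tsum_of_isPreconnected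
    (f := fun n L => 1 / (n.factorial : ℝ) * detIntegral μ L n)
    (f' := fun n L => termDeriv μ L n) hu Metric.isOpen_ball
    (convex_ball (0 : C(X × X, ℝ)) R).isPreconnected (fun n L _ => hasFDerivAt_term μ L n)
    (fun n L hL => ?_) hK (summable_det μ K) hK
  rw [mem_ball_zero_iff] at hL
  cases n with
  | zero => rw [termDeriv_zero, norm_zero]; positivity
  | succ n =>
    refine (norm_termDeriv_succ_le μ L n).trans ?_
    rw [Nat.add_sub_cancel]
    gcongr

theorem _root_.ContinuousLinearMap.summable_of_norm {E : Type*} [NormedAddCommGroup E]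
    [NormedSpace ℝ E] (f : ℕ → E →L[ℝ] ℝ) (h : Summable fun n => ‖f n‖) : Summable f :=
  h.of_norm

theorem summable_termDeriv (K : C(X × X, ℝ)) : Summable (termDeriv μ K) := by
  refine ContinuousLinearMap.summable_of_norm _ ((summable_nat_add_iff 1).mp ?_)
  exact Summable.of_nonneg_of_le (fun _ => ContinuousLinearMap.opNorm_nonneg _)
    (norm_termDeriv_succ_le μ K) (summable_hadamard ‖K‖ (norm_nonneg K))

theorem continuous_det : Continuous (det μ) :=
  continuous_iff_continuousAt.mpr fun K => (hasFDerivAt_det μ K).continuousAt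

theorem det_zero : det μ (0 : C(X × X, ℝ)) = 1 := by
  rw [det, tsum_eq_single 0]
  · simp [detIntegral_zero]
  · intro n hn
    obtain ⟨m, rfl⟩ := Nat.exists_eq_succ_of_ne_zero hn
    have : (Matrix.of fun _ _ : Fin (m + 1) => (0 : ℝ)).det = 0 :=
      Matrix.det_eq_zero_of_row_eq_zero 0 fun _ => rfl
    simp [detIntegral, this]

theorem minorTerm_zero (K : C(X × X, ℝ)) : minorTerm μ K 0 = K := by
  ext p; simp [minorTerm, minorIntegral_zero]

/-- The recursion for the terms of the first minor. -/
theorem minorTerm_succ (K : C(X × X, ℝ)) (n : ℕ) (t : X) :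
    column (minorTerm μ K (n + 1)) t =
      (1 / ((n + 1).factorial : ℝ) * detIntegral μ K (n + 1)) • column K t -
        integralOp μ K (column (minorTerm μ K n) t) := by
  ext s
  simp only [column_apply, minorTerm, ContinuousMap.coe_mk, minorIntegral_succ,
    ContinuousMap.sub_apply, ContinuousMap.smul_apply, integralOp_apply, smul_eq_mul]
  have : ∀ z, K (s, z) * (1 / (n.factorial : ℝ) * minorIntegral μ K n z t) =
      1 / (n.factorial : ℝ) * (K (s, z) * minorIntegral μ K n z t) := fun z => by ring
  simp_rw [this]
  rw [integral_const_mul, Nat.factorial_succ]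
  have hf : (n.factorial : ℝ) ≠ 0 := by exact_mod_cast n.factorial_ne_zero
  have hn : (n : ℝ) + 1 ≠ 0 := by positivity
  push_cast
  field_simp

/-- The column of Fredholm's first minor. -/
theorem hasSum_column_minorTerm (K : C(X × X, ℝ)) (t : X) {S : C(X, ℝ) →L[ℝ] C(X, ℝ)}
    (hS : S * (1 + integralOp μ K) = 1) :
    HasSum (fun n => column (minorTerm μ K n) t) (det μ K • S (column K t)) := by
  have hn : ∀ L : C(X × X, ℝ), ‖column L t‖ ≤ ‖L‖ := fun L => by
    rw [ContinuousMap.norm_le _ (norm_nonneg _)]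
    exact fun s => L.norm_coe_le_norm (s, t)
  have hsum : Summable fun n => column (minorTerm μ K n) t :=
    Summable.of_norm_bounded (summable_norm_minorTerm μ K) fun n => hn _
  set N := ∑' n, column (minorTerm μ K n) t with hN
  -- Summing the recursion `minorTerm_succ` over n gives (1 + K) N = det • K (·, t); a left inverse
  -- of 1 + K then determines N.
  have h1 : N + integralOp μ K N = det μ K • column K t := by
    have hd := (summable_det μ K).hasSum
    rw [← hasSum_nat_add_iff' 1] at hd
    have hs := hsum.hasSum
    have ho := hs.mapL (integralOp μ K)
    rw [← hasSum_nat_add_iff' 1] at hs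
    have h2 := (hd.smul_const (column K t)).sub ho
    simp_rw [← minorTerm_succ] at h2
    have h3 := hs.unique h2
    simp only [Finset.range_one, Finset.sum_singleton, minorTerm_zero, Nat.factorial_zero,
      Nat.cast_one, detIntegral_zero, sub_smul, div_one, mul_one, one_smul] at h3
    rw [← hN] at h3
    rw [det]
    linear_combination (norm := module) h3
  have h2 : N = det μ K • S (column K t) := by
    rw [← map_smul, ← h1]
    calc N = (1 : C(X, ℝ) →L[ℝ] C(X, ℝ)) N := rfl
      _ = _ := by rw [← hS]; simp
  rw [← h2]
  exact hsum.hasSum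

theorem termDeriv_one (K H : C(X × X, ℝ)) : termDeriv μ K 1 H = ∫ t, H (t, t) ∂μ := by
  simp [termDeriv_apply, detForm_update]

/-- All n + 2 rows contribute equally, which turns 1 / (n + 2)! into 1 / (n + 1)!. What remains is
the trace of H times a determinant term, minus H paired with a minor term. -/
theorem termDeriv_add_two (K H : C(X × X, ℝ)) (n : ℕ) :
    termDeriv μ K (n + 2) H =
      (1 / ((n + 1).factorial : ℝ) * detIntegral μ K (n + 1)) * ∫ t, H (t, t) ∂μ -
        ∫ t, integralCLM μ (H.curry t * column (minorTerm μ K n) t) ∂μ := by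
  have h : ∀ i : Fin (n + 2), detForm μ (n + 2) (Function.update (fun _ => K) i H) =
      detIntegral μ K (n + 1) * ∫ t, H (t, t) ∂μ - ((n + 1).factorial : ℝ) *
        ∫ t, integralCLM μ (H.curry t * column (minorTerm μ K n) t) ∂μ := by
    intro i
    rw [detForm_update, ← integral_const_mul, ← integral_const_mul, ← integral_sub]
    · congr 1
      funext t
      have := integral_det_cons_row μ K (H.curry t) t n
      simp only [ContinuousMap.curry_apply] at this
      rw [this, mul_comm (H (t, t)), ← integral_const_mul, integralCLM_apply,
        ← integral_const_mul]
      congr 2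
      funext z
      simp only [minorTerm, ContinuousMap.mul_apply, ContinuousMap.curry_apply, column_apply,
        ContinuousMap.coe_mk, Nat.factorial_succ]
      have hf : (n.factorial : ℝ) ≠ 0 := by exact_mod_cast n.factorial_ne_zero
      push_cast
      field_simp
    · exact integrable_of_continuous μ (by fun_prop)
    · exact integrable_of_continuous μ (by fun_prop)
  rw [termDeriv_apply, Finset.sum_congr rfl fun i _ => h i, Nat.factorial_succ (n + 1)]
  have hf : ((n + 1).factorial : ℝ) ≠ 0 := by exact_mod_cast (n + 1).factorial_ne_zero
  have hn : (n : ℝ) + 1 + 1 ≠ 0 := by positivity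
  simp only [Finset.sum_const, Finset.card_univ, Fintype.card_fin, nsmul_eq_mul]
  push_cast
  field_simp
  ring

/-- The logarithmic derivative of the Fredholm determinant. -/
theorem fderiv_det_apply (K H : C(X × X, ℝ)) {S : C(X, ℝ) →L[ℝ] C(X, ℝ)}
    (hS : S * (1 + integralOp μ K) = 1) :
    (∑' n, termDeriv μ K n) H =
      det μ K * ∫ t, (H (t, t) - integralCLM μ (H.curry t * S (column K t))) ∂μ := by
  -- The claimed integral is formally the trace of H S, because S (1 + K) = 1 means 1 - S K = S.
  set φ : ℕ → C(X, ℝ) := fun n =>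
    ⟨fun t => integralCLM μ (H.curry t * column (minorTerm μ K n) t), by fun_prop⟩ with hφ
  have hsum : Summable φ := by
    refine Summable.of_norm_bounded ((summable_norm_minorTerm μ K).mul_left ‖H‖) fun n => ?_
    rw [ContinuousMap.norm_le _ (by positivity)]
    refine fun t => (norm_integralCLM_le μ _).trans ((norm_mul_le _ _).trans ?_)
    gcongr
    · rw [ContinuousMap.norm_le _ (by positivity)]
      exact fun z => H.norm_coe_le_norm (t, z)
    · rw [ContinuousMap.norm_le _ (by positivity)]
      exact fun z => (minorTerm μ K n).norm_coe_le_norm (z, t)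
  have hval : ∀ t, (∑' n, φ n) t = det μ K * integralCLM μ (H.curry t * S (column K t)) := by
    intro t
    have h1 := hsum.hasSum.mapL (ContinuousMap.evalCLM ℝ t)
    have h2 := (((hasSum_column_minorTerm μ K t hS).mul_left (H.curry t))).mapL (integralCLM μ)
    rw [mul_smul_comm, map_smul] at h2
    exact h1.unique h2
  -- Derivative term n + 2 uses determinant term n + 1 and minor term n. Hence two terms are split
  -- off here and one from the determinant: index 0 vanishes and index 1 is the trace of H.
  have h1 := (summable_termDeriv μ K).hasSum.mapL (ContinuousLinearMap.apply ℝ ℝ H)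
  rw [← hasSum_nat_add_iff' 2] at h1
  have h2 := (summable_det μ K).hasSum
  rw [← hasSum_nat_add_iff' 1] at h2
  have h3 := (h2.mul_right (∫ t, H (t, t) ∂μ)).sub (hsum.hasSum.mapL (integralCLM μ))
  have h4 := h1.unique (h3.congr_fun fun n => termDeriv_add_two μ K H n)
  simp only [Finset.sum_range_succ, Finset.range_zero, Finset.sum_empty, termDeriv_zero,
    ContinuousLinearMap.apply_apply, termDeriv_one, integralCLM_apply, hval,
    integral_const_mul, zero_apply, detIntegral_zero] at h4
  rw [integral_sub (integrable_of_continuous μ (by fun_prop))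
    (integrable_of_continuous μ (by fun_prop)), det]
  simp only [integralCLM_apply] at h4 ⊢
  rw [det] at h4
  simp at h4
  simp
  linear_combination h4

end Fredholm
end

/-! ### Curves of kernels, compactness and the Fredholm alternative. -/

noncomputable section

namespace Fredholm

set_option linter.unusedSectionVars false

variable {X : Type*} [TopologicalSpace X] [CompactSpace X]

section Curves

theorem hasDerivAt_clm_apply₂ {E F G : Type*} [NormedAddCommGroup E] [NormedSpace ℝ E]
    [NormedAddCommGroup F] [NormedSpace ℝ F] [NormedAddCommGroup G] [NormedSpace ℝ G]
    (L : E →L[ℝ] F →L[ℝ] G) {c : ℝ → E} {c' : E} {f : ℝ → F} {f' : F} {u : ℝ}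
    (hc : HasDerivAt c c' u) (hf : HasDerivAt f f' u) :
    HasDerivAt (fun v => L (c v) (f v)) (L c' (f u) + L (c u) f') u :=
  (L.hasFDerivAt.comp_hasDerivAt u hc).clm_apply hf

/-- Solutions of `p + L c p = f` depend on the parameter as smoothly as the data. -/
theorem contDiff_of_add_clm_apply₂_eq {E F : Type*} [NormedAddCommGroup E] [NormedSpace ℝ E]
    [NormedAddCommGroup F] [NormedSpace ℝ F] [CompleteSpace F]
    (L : E →L[ℝ] F →L[ℝ] F) {c : ℝ → E} {f p : ℝ → F} (hc : ContDiff ℝ 1 c)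
    (hf : ContDiff ℝ 1 f) (hp : ∀ v, p v + L (c v) (p v) = f v)
    (hu : ∀ v, ∃ S : F →L[ℝ] F, (∀ x, S (x + L (c v) x) = x) ∧ ∀ x, S x + L (c v) (S x) = x) :
    ContDiff ℝ 1 p := by
  have h1 : ContDiff ℝ 1 fun v => 1 + L (c v) := contDiff_const.add (L.contDiff.comp hc)
  have hu' : ∀ v, IsUnit (1 + L (c v)) := by
    intro v
    obtain ⟨S, hS, hS'⟩ := hu v
    exact ⟨⟨1 + L (c v), S, by ext x; exact hS' x, by ext x; exact hS x⟩, rfl⟩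
  have h2 : ContDiff ℝ 1 fun v => Ring.inverse (1 + L (c v)) := by
    rw [contDiff_iff_contDiffAt]
    intro v
    obtain ⟨x, hx⟩ := hu' v
    have := contDiffAt_ringInverse (n := 1) ℝ x
    rw [hx] at this
    exact this.comp v h1.contDiffAt
  have hpe : p = fun v => Ring.inverse (1 + L (c v)) (f v) := by
    funext v
    rw [← hp v]
    exact (congrArg (fun T : F →L[ℝ] F => T (p v)) (Ring.inverse_mul_cancel _ (hu' v))).symm
  rw [hpe]
  exact h2.clm_apply hf

/-- A family of continuous functions with a jointly continuous derivative in the parameter is a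
differentiable curve in the space of continuous functions. -/
theorem hasDerivAt_curry {F F' : C(ℝ × X, ℝ)}
    (h : ∀ u x, HasDerivAt (fun v => F (v, x)) (F' (u, x)) u) (u : ℝ) :
    HasDerivAt (fun v => F.curry v) (F'.curry u) u := by
  have hc : Continuous fun v => F'.curry v := F'.curry.continuous
  -- Evaluation at each point identifies the curve with a primitive, in the space of continuous
  -- functions, of the continuous curve `F'.curry`; the fundamental theorem of calculus then applies
  -- in norm.
  have heq : (fun v => F.curry v) = fun v => F.curry 0 + ∫ w in (0 : ℝ)..v, F'.curry w := by
    funext v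
    ext x
    have h1 := (ContinuousMap.evalCLM ℝ x).intervalIntegral_comp_comm (hc.intervalIntegrable (μ := volume) 0 v)
    have h2 := intervalIntegral.integral_eq_sub_of_hasDerivAt (a := 0) (b := v)
      (fun w _ => h w x)
      ((F'.continuous.comp (Continuous.prodMk_left x)).intervalIntegrable 0 v)
    simp only [ContinuousMap.evalCLM_apply] at h1
    rw [ContinuousMap.add_apply, ← h1]
    simp only [ContinuousMap.curry_apply, h2]
    ring
  rw [heq]
  exact (hc.integral_hasStrictDerivAt 0 u).hasDerivAt.const_add _

theorem contDiff_one_curry {F F' : C(ℝ × X, ℝ)}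
    (h : ∀ u x, HasDerivAt (fun v => F (v, x)) (F' (u, x)) u) :
    ContDiff ℝ 1 fun v => F.curry v := by
  rw [contDiff_one_iff_deriv]
  refine ⟨fun u => (hasDerivAt_curry h u).differentiableAt, ?_⟩
  rw [funext fun u => (hasDerivAt_curry h u).deriv]
  exact F'.curry.continuous

end Curves

variable [SecondCountableTopology X] [MeasurableSpace X] [BorelSpace X] (μ : Measure X)
  [IsProbabilityMeasure μ]

theorem hasDerivAt_det_comp {K : ℝ → C(X × X, ℝ)} {H : C(X × X, ℝ)} {u : ℝ}
    (hK : HasDerivAt K H u) {S : C(X, ℝ) →L[ℝ] C(X, ℝ)}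
    (hS : S * (1 + integralOp μ (K u)) = 1) :
    HasDerivAt (fun v => det μ (K v)) (det μ (K u) *
      ∫ t, (H (t, t) - integralCLM μ (H.curry t * S (column (K u) t))) ∂μ) u := by
  rw [← fderiv_det_apply μ (K u) H hS]
  exact (hasFDerivAt_det μ (K u)).comp_hasDerivAt u hK

/-- Integral operators with continuous kernels are compact. -/
theorem isCompactOperator_integralOp (K : C(X × X, ℝ)) :
    IsCompactOperator (integralOp μ K) := by
  have hK : ∀ s, ‖K.curry s‖ ≤ ‖K‖ := fun s => by
    rw [ContinuousMap.norm_le _ (norm_nonneg _)]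
    exact fun z => K.norm_coe_le_norm (s, z)
  -- The image of the unit ball has a bound and a modulus of continuity that depend only on K, as
  -- Arzelà–Ascoli requires.
  set P : (X → ℝ) → Prop := fun g => (∀ s, g s ∈ Set.Icc (-‖K‖) ‖K‖) ∧
    ∀ s s', |g s - g s'| ≤ ‖K.curry s - K.curry s'‖ with hP
  have hcont : ∀ g, P g → Continuous g := by
    refine fun g hg => continuous_iff_continuousAt.mpr fun s => ?_
    rw [ContinuousAt, tendsto_iff_norm_sub_tendsto_zero]
    refine squeeze_zero (fun _ => norm_nonneg _) (fun s' => hg.2 s' s) ?_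
    exact tendsto_iff_norm_sub_tendsto_zero.mp K.curry.continuous.continuousAt
  -- P already implies continuity, so no function is lost on passing to the product space, where P
  -- cuts out a closed subset of a product of compact intervals.
  have himg : ContinuousMap.toFun '' {f : C(X, ℝ) | P f} = {g | P g} := by
    ext g
    constructor
    · rintro ⟨f, hf, rfl⟩; exact hf
    · exact fun hg => ⟨⟨g, hcont g hg⟩, hg, rfl⟩
  refine (isCompactOperator_iff_image_ball_subset_compact
    (integralOp μ K : C(X, ℝ) →ₗ[ℝ] C(X, ℝ)) one_pos).mpr ⟨{f : C(X, ℝ) | P f}, ArzelaAscoli.isCompact_of_equicontinuous _ ?_ ?_, ?_⟩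
  · rw [himg]
    refine (isCompact_univ_pi fun _ : X => isCompact_Icc (a := -‖K‖) (b := ‖K‖)).of_isClosed_subset
      ?_ fun g hg s _ => hg.1 s
    have : {g | P g} = (⋂ s, {g : X → ℝ | g s ∈ Set.Icc (-‖K‖) ‖K‖}) ∩
        ⋂ s, ⋂ s', {g : X → ℝ | |g s - g s'| ≤ ‖K.curry s - K.curry s'‖} := by
      ext g; simp [hP]
    rw [this]
    refine (isClosed_iInter fun s => isClosed_Icc.preimage (continuous_apply s)).inter
      (isClosed_iInter fun s => isClosed_iInter fun s' => isClosed_le (by fun_prop) (by fun_prop))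
  · intro s
    rw [Metric.equicontinuousAt_iff_right]
    intro ε hε
    have h := (Metric.tendsto_nhds.mp (K.curry.continuous.tendsto s)) ε hε
    filter_upwards [h] with s' hs' f
    rw [dist_eq_norm, ← norm_neg, neg_sub] at hs'
    exact (f.2.2 s s').trans_lt hs'
  · rintro _ ⟨f, hf, rfl⟩
    rw [mem_ball_zero_iff] at hf
    have hb : ∀ L : C(X, ℝ), |integralCLM μ (L * f)| ≤ ‖L‖ := fun L =>
      (norm_integralCLM_le μ _).trans ((norm_mul_le _ _).trans
        (mul_le_of_le_one_right (norm_nonneg _) hf.le))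
    refine ⟨fun s => abs_le.mp ((hb (K.curry s)).trans (hK s)), fun s s' => ?_⟩
    have : integralOp μ K f s - integralOp μ K f s' =
        integralCLM μ ((K.curry s - K.curry s') * f) := by
      rw [sub_mul, map_sub]; rfl
    exact (congrArg abs this).trans_le (hb _)

/-- The **Fredholm alternative** for `1 + K`. -/
theorem isUnit_one_add_integralOp (K : C(X × X, ℝ))
    (h : ∀ f : C(X, ℝ), f + integralOp μ K f = 0 → f = 0) : IsUnit (1 + integralOp μ K) := by
  rcases (isCompactOperator_integralOp μ K).hasEigenvalue_or_mem_resolventSet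
    (neg_ne_zero.mpr one_ne_zero : (-1 : ℝ) ≠ 0) with he | hr
  · obtain ⟨f, hf⟩ := he.exists_hasEigenvector
    refine absurd (h f ?_) hf.2
    have := hf.apply_eq_smul
    rw [ContinuousLinearMap.coe_coe] at this
    rw [this]; simp
  · rw [spectrum.mem_resolventSet_iff] at hr
    have : algebraMap ℝ (C(X, ℝ) →L[ℝ] C(X, ℝ)) (-1) - integralOp μ K =
        -(1 + integralOp μ K) := by
      rw [map_neg, map_one]; abel
    rw [this] at hr
    exact IsUnit.neg_iff _ |>.mp hr

theorem integralCLM_mul_integralOp_comm {K : C(X × X, ℝ)} (hK : ∀ s t, K (s, t) = K (t, s))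
    (f g : C(X, ℝ)) :
    integralCLM μ (f * integralOp μ K g) = integralCLM μ (g * integralOp μ K f) := by
  simp only [integralCLM_apply, ContinuousMap.mul_apply, integralOp_apply, ← integral_const_mul]
  rw [integral_integral_swap]
  · refine integral_congr_ae (Filter.Eventually.of_forall fun z => ?_)
    refine integral_congr_ae (Filter.Eventually.of_forall fun s => ?_)
    simp only [hK s z]; ring
  · exact integrable_of_continuous _ (by fun_prop)

end Fredholm
end

/-! ### Plancherel's theorem for the Fourier integral. -/

noncomputable section

section Plancherel
open FourierTransform
open scoped ContDiff

/-- For an integrable and square-integrable function, the Fourier integral represents the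
`L²` Fourier transform. -/
theorem MeasureTheory.MemLp.fourier_toLp_ae_eq {g : ℝ → ℂ} (h1 : Integrable g)
    (h2 : MemLp g 2 volume) : (𝓕 (h2.toLp g) : Lp ℂ 2 (volume : Measure ℝ)) =ᵐ[volume] 𝓕 g := by
  have hcont : Continuous (𝓕 g) := by
    have := VectorFourier.fourierIntegral_continuous Real.continuous_fourierChar
      (L := innerₗ ℝ) (by fun_prop) h1
    exact this
  -- Against a test function both transforms satisfy ∫ η 𝓕g = ∫ g 𝓕η: the L² one through tempered
  -- distributions, the integral one by Fubini.
  refine ae_eq_of_integral_contDiff_smul_eq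
    ((Lp.memLp _).locallyIntegrable one_le_two) hcont.locallyIntegrable fun η hη hη' => ?_
  have hs1 : HasCompactSupport fun x => (η x : ℂ) := hη'.comp_left Complex.ofReal_zero
  have hs2 : ContDiff ℝ ∞ fun x => (η x : ℂ) := Complex.ofRealCLM.contDiff.comp hη
  set s : SchwartzMap ℝ ℂ := hs1.toSchwartzMap hs2 with hs
  have hd := congrArg (fun T => T s) (Lp.fourier_toTemperedDistribution_eq (h2.toLp g))
  simp only [TemperedDistribution.fourier_apply, Lp.toTemperedDistribution_apply] at hd
  calc ∫ x, η x • (𝓕 (h2.toLp g) : Lp ℂ 2 (volume : Measure ℝ)) x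
      = ∫ x, s x • (𝓕 (h2.toLp g) : Lp ℂ 2 (volume : Measure ℝ)) x := by
        simp [hs]
    _ = ∫ x, (𝓕 s) x • (h2.toLp g) x := hd.symm
    _ = ∫ x, (𝓕 s) x * g x := by
        refine integral_congr_ae ?_
        filter_upwards [h2.coeFn_toLp] with x hx
        rw [hx, smul_eq_mul]
    _ = ∫ x, s x * 𝓕 g x := by
        have := VectorFourier.integral_fourierIntegral_smul_eq_flip (L := innerₗ ℝ)
          (μ := volume) (ν := volume) (f := s) (g := g) Real.continuous_fourierChar (by fun_prop)
          s.integrable h1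
        rw [flip_innerₗ] at this
        rw [SchwartzMap.fourier_coe]
        exact this
    _ = ∫ x, η x • 𝓕 g x := by simp [hs]

/-- **Plancherel's theorem** for functions in `L¹ ∩ L²`. -/
theorem integrable_and_integral_norm_sq_fourier {g : ℝ → ℂ} (h1 : Integrable g)
    (h2 : MemLp g 2 volume) : MemLp (𝓕 g) 2 volume ∧ ∫ x, ‖𝓕 g x‖ ^ 2 = ∫ x, ‖g x‖ ^ 2 := by
  have hae := h2.fourier_toLp_ae_eq h1
  refine ⟨(memLp_congr_ae hae).mp (Lp.memLp _), ?_⟩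
  have hn := Lp.norm_fourier_eq (h2.toLp g)
  rw [Lp.norm_def, Lp.norm_def, eLpNorm_congr_ae hae, eLpNorm_congr_ae h2.coeFn_toLp,
    ((memLp_congr_ae hae).mp (Lp.memLp _)).eLpNorm_eq_integral_rpow_norm two_ne_zero
      ENNReal.ofNat_ne_top, h2.eLpNorm_eq_integral_rpow_norm two_ne_zero ENNReal.ofNat_ne_top,
    ENNReal.toReal_ofReal (by positivity), ENNReal.toReal_ofReal (by positivity)] at hn
  simp only [ENNReal.toReal_ofNat, Real.rpow_ofNat] at hn
  exact (Real.rpow_left_inj (integral_nonneg fun _ => by positivity)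
    (integral_nonneg fun _ => by positivity) (by norm_num)).mp hn

end Plancherel
end

/-! ### The rescaled cosine kernel and the invertibility of 1 ± K. -/

noncomputable section

open scoped unitInterval

theorem unitInterval.integral_eq_intervalIntegral (f : ℝ → ℝ) :
    ∫ z : I, f z = ∫ z in (0 : ℝ)..1, f z := by
  rw [unitInterval.measurePreserving_coe.integral_comp unitInterval.measurableEmbedding_coe f,
    integral_Icc_eq_integral_Ioc, intervalIntegral.integral_of_le zero_le_one]

/-- An integral with compact domain of a family of entire functions is entire. -/
theorem differentiable_integral_of_continuous {X : Type*} [TopologicalSpace X] [CompactSpace X]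
    [MeasurableSpace X] [BorelSpace X] (ν : Measure X) [IsFiniteMeasure ν] {F F' : ℂ → X → ℂ}
    (hF : Continuous (Function.uncurry F)) (hF' : Continuous (Function.uncurry F'))
    (h : ∀ w x, HasDerivAt (fun w => F w x) (F' w x) w) :
    Differentiable ℂ fun w => ∫ x, F w x ∂ν := by
  intro w₀
  obtain ⟨C, hC⟩ := ((isCompact_closedBall w₀ 1).prod (isCompact_univ (X := X))).exists_bound_of_continuousOn
    hF'.continuousOn
  have hm : ∀ {G : ℂ → X → ℂ}, Continuous (Function.uncurry G) → ∀ w,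
      Integrable (G w) ν := fun {G} hG w =>
    (BoundedContinuousFunction.mkOfCompact
      (⟨G w, hG.comp (Continuous.prodMk_right w)⟩ : C(X, ℂ))).integrable ν
  exact (hasDerivAt_integral_of_dominated_loc_of_deriv_le (bound := fun _ => C)
    (Metric.ball_mem_nhds w₀ one_pos)
    (Filter.Eventually.of_forall fun w => (hm hF w).aestronglyMeasurable) (hm hF w₀)
    (hm hF' w₀).aestronglyMeasurable
    (Filter.Eventually.of_forall fun x w hw => hC (w, x) ⟨Metric.ball_subset_closedBall hw, trivial⟩)
    (integrable_const _)
    (Filter.Eventually.of_forall fun x w _ => h w x)).2.differentiableAt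

/-- The profile `t ↦ 2 a cos (2 π a² t)` of the rescaled kernel. -/
def cosProfile (a t : ℝ) : ℝ := 2 * a * Real.cos (2 * Real.pi * a ^ 2 * t)

/-- The kernel of `F_a⁺` on even functions, rescaled to `[0, 1]`. -/
def cosKernel (a : ℝ) : C(I × I, ℝ) :=
  ⟨fun p => cosProfile a (p.1 * p.2), by unfold cosProfile; fun_prop⟩

theorem cosKernel_apply (a : ℝ) (x y : I) : cosKernel a (x, y) = cosProfile a (x * y) := rfl

/-- The kernel `cosProfile a (x * z)` for real `x`. -/
def cosCurve (a : ℝ) : C(ℝ × I, ℝ) :=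
  ⟨fun p => cosProfile a (p.1 * p.2), by unfold cosProfile; fun_prop⟩

theorem cosCurve_apply (a x : ℝ) (z : I) : cosCurve a (x, z) = cosProfile a (x * z) := rfl

/-- On even functions, `ℱ₊ P_a` is an integral over `[0, 1]`. -/
theorem cosTransform_restrictTo {a : ℝ} (ha : 0 < a) {φ : ℝ → ℝ}
    (hφ : ∀ x, φ (-x) = φ x) (x : ℝ) :
    cosTransform (restrictTo a φ) (a * x) = ∫ z : I, cosProfile a (x * z) * φ (a * z) := by
  have habs : ∀ y, φ |y| = φ y := fun y => by
    rcases abs_choice y with h | h <;> rw [h]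
    exact hφ y
  set F : ℝ → ℝ := fun y =>
    Real.cos (2 * Real.pi * y * (a * x)) * restrictTo a φ y with hF
  have h1 : ∀ y, F |y| = F y := by
    intro y
    have e1 : Real.cos (2 * Real.pi * |y| * (a * x)) = Real.cos (2 * Real.pi * y * (a * x)) := by
      rw [← Real.cos_abs, ← Real.cos_abs (2 * Real.pi * y * (a * x))]
      congr 1
      simp [abs_mul]
    have e2 : restrictTo a φ |y| = restrictTo a φ y := by
      unfold restrictTo
      by_cases hy : |y| ≤ a
      · rw [Set.indicator_of_mem (show y ∈ Set.Icc (-a) a from abs_le.mp hy),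
          Set.indicator_of_mem, habs]
        exact ⟨by linarith [abs_nonneg y], hy⟩
      · rw [Set.indicator_of_notMem (show y ∉ Set.Icc (-a) a from fun h => hy (abs_le.mpr h)),
          Set.indicator_of_notMem]
        exact fun h => hy h.2
    simp only [hF, e1, e2]
  have h2 : cosTransform (restrictTo a φ) (a * x) = 2 * ∫ y in Set.Ioi (0 : ℝ), F y := by
    rw [← integral_comp_abs]
    simp only [h1]
    rfl
  have h3 : ∫ y in Set.Ioi (0 : ℝ), F y =
      ∫ y in (0 : ℝ)..a, Real.cos (2 * Real.pi * y * (a * x)) * φ y := by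
    rw [intervalIntegral.integral_of_le ha.le, ← integral_indicator measurableSet_Ioi,
      ← integral_indicator measurableSet_Ioc]
    congr 1
    funext y
    by_cases hy : 0 < y
    · by_cases hy' : y ≤ a
      · rw [Set.indicator_of_mem (show y ∈ Set.Ioi 0 from hy),
          Set.indicator_of_mem (show y ∈ Set.Ioc 0 a from ⟨hy, hy'⟩)]
        simp only [hF, restrictTo]
        rw [Set.indicator_of_mem (show y ∈ Set.Icc (-a) a from ⟨by linarith, hy'⟩)]
      · rw [Set.indicator_of_mem (show y ∈ Set.Ioi 0 from hy),
          Set.indicator_of_notMem (fun h => hy' h.2)]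
        simp only [hF, restrictTo]
        rw [Set.indicator_of_notMem (fun h => hy' h.2), mul_zero]
    · rw [Set.indicator_of_notMem (show y ∉ Set.Ioi 0 from hy),
        Set.indicator_of_notMem (fun h => hy h.1)]
  have h4 := intervalIntegral.integral_comp_mul_left (a := 0) (b := 1)
    (fun y => Real.cos (2 * Real.pi * y * (a * x)) * φ y) ha.ne'
  rw [mul_zero, mul_one, smul_eq_mul] at h4
  rw [h2, h3, unitInterval.integral_eq_intervalIntegral (fun z => cosProfile a (x * z) * φ (a * z))]
  have h5 : ∀ z, cosProfile a (x * z) * φ (a * z) =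
      2 * a * (Real.cos (2 * Real.pi * (a * z) * (a * x)) * φ (a * z)) := by
    intro z
    rw [cosProfile, show 2 * Real.pi * (a * z) * (a * x) = 2 * Real.pi * a ^ 2 * (x * z) by ring]
    ring
  simp_rw [h5]
  rw [intervalIntegral.integral_const_mul, h4, mul_assoc, mul_inv_cancel_left₀ ha.ne']

section Injectivity
open FourierTransform

/-- The Fourier transform of an even real function is its cosine transform. -/
theorem fourier_ofReal_eq_cosTransform {g : ℝ → ℝ} (hg : Integrable g)
    (heven : ∀ x, g (-x) = g x) (ξ : ℝ) :
    𝓕 (fun x => (g x : ℂ)) ξ = cosTransform g ξ := by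
  have h1 : ∀ x : ℝ, Complex.exp (↑(-2 * Real.pi * x * ξ) * Complex.I) • (g x : ℂ) =
      ((Real.cos (2 * Real.pi * x * ξ) * g x : ℝ) : ℂ) -
        ((Real.sin (2 * Real.pi * x * ξ) * g x : ℝ) : ℂ) * Complex.I := by
    intro x
    rw [Complex.exp_mul_I, ← Complex.ofReal_cos, ← Complex.ofReal_sin,
      show -2 * Real.pi * x * ξ = -(2 * Real.pi * x * ξ) by ring, Real.cos_neg, Real.sin_neg]
    push_cast
    simp only [smul_eq_mul]
    ring
  have hcos : Integrable fun x => Real.cos (2 * Real.pi * x * ξ) * g x :=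
    hg.bdd_mul (c := 1) (by fun_prop) (Filter.Eventually.of_forall fun x => Real.abs_cos_le_one _)
  have hsin : Integrable fun x => Real.sin (2 * Real.pi * x * ξ) * g x :=
    hg.bdd_mul (c := 1) (by fun_prop) (Filter.Eventually.of_forall fun x => Real.abs_sin_le_one _)
  have h2 : ∫ x, Real.sin (2 * Real.pi * x * ξ) * g x = 0 := by
    have h := integral_neg_eq_self (fun x => Real.sin (2 * Real.pi * x * ξ) * g x) volume
    have h' : ∀ x, Real.sin (2 * Real.pi * (-x) * ξ) * g (-x) =
        -(Real.sin (2 * Real.pi * x * ξ) * g x) := by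
      intro x
      rw [heven, show 2 * Real.pi * (-x) * ξ = -(2 * Real.pi * x * ξ) by ring, Real.sin_neg]
      ring
    simp_rw [h'] at h
    rw [integral_neg] at h
    linarith
  rw [Real.fourier_real_eq_integral_exp_smul]
  simp_rw [h1]
  rw [integral_sub hcos.ofReal (hsin.ofReal.mul_const _), integral_mul_const,
    integral_complex_ofReal, integral_complex_ofReal, h2, cosTransform]
  simp

/-- `1` and `-1` are not eigenvalues of `F_a⁺`. -/
theorem eq_zero_of_eq_cosTransform {a ε : ℝ} (ha : 0 < a) (hε : ε ^ 2 = 1) {φ : ℝ → ℝ}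
    (hcont : Continuous φ) (heven : ∀ x, φ (-x) = φ x)
    (hφ : ∀ x, φ x = ε * cosTransform (restrictTo a φ) x) : φ = 0 := by
  set g := restrictTo a φ with hg
  have hg1 : Integrable g :=
    (hcont.continuousOn.integrableOn_compact isCompact_Icc).integrable_indicator measurableSet_Icc
  have hg2 : MemLp g 2 volume := by
    obtain ⟨C, hC⟩ := (isCompact_Icc (a := -a) (b := a)).exists_bound_of_continuousOn
      hcont.continuousOn
    exact (memLp_indicator_iff_restrict measurableSet_Icc).mpr
      (MemLp.of_bound hcont.aestronglyMeasurable C (ae_restrict_of_forall_mem measurableSet_Icc hC))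
  have hgeven : ∀ x, g (-x) = g x := by
    intro x
    simp only [hg, restrictTo, Set.indicator_apply, Set.mem_Icc, heven]
    congr 1
    rw [neg_le_neg_iff, neg_le, and_comm]
  have hF : ∀ ξ, ‖𝓕 (fun x => (g x : ℂ)) ξ‖ ^ 2 = φ ξ ^ 2 := by
    intro ξ
    rw [fourier_ofReal_eq_cosTransform hg1 hgeven, hφ ξ, mul_pow, hε, one_mul,
      Complex.norm_real, Real.norm_eq_abs, sq_abs]
  obtain ⟨hL, hP⟩ := integrable_and_integral_norm_sq_fourier hg1.ofReal hg2.ofReal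
  have hint : Integrable fun x => φ x ^ 2 := by
    have := hL.integrable_norm_pow two_ne_zero
    refine this.congr (Filter.Eventually.of_forall fun x => ?_)
    simpa using hF x
  -- Here |φ| is the modulus of the Fourier transform of P_aφ, so Plancherel leaves no mass for φ
  -- outside [-a, a].
  have hsq : ∫ x, φ x ^ 2 = ∫ x in Set.Icc (-a) a, φ x ^ 2 := by
    have h : ∫ x, ‖𝓕 (fun x => (g x : ℂ)) x‖ ^ 2 = ∫ x, ‖((g x : ℝ) : ℂ)‖ ^ 2 := hP
    simp_rw [hF] at h
    rw [h, ← integral_indicator measurableSet_Icc]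
    congr 1
    funext x
    rw [Complex.norm_real, Real.norm_eq_abs, sq_abs, hg, restrictTo]
    simp only [Set.indicator_apply]
    split_ifs <;> simp
  have hout : ∀ x ∈ Set.Ioi a, φ x = 0 := by
    have h0 : ∫ x in (Set.Icc (-a) a)ᶜ, φ x ^ 2 = 0 := by
      have := integral_add_compl (measurableSet_Icc (a := -a) (b := a)) hint
      linarith
    have h1 : ∫ x in Set.Ioi a, φ x ^ 2 = 0 := by
      refine le_antisymm ?_ (integral_nonneg fun x => sq_nonneg _)
      rw [← h0]
      refine setIntegral_mono_set hint.integrableOn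
        (Filter.Eventually.of_forall fun x => sq_nonneg _) (LE.le.eventuallyLE ?_)
      exact fun x hx hx' => not_lt.mpr hx'.2 hx
    rw [integral_eq_zero_iff_of_nonneg (fun x => sq_nonneg _) hint.integrableOn] at h1
    have h2 := Measure.eqOn_open_of_ae_eq h1 isOpen_Ioi (hcont.pow 2).continuousOn
      continuousOn_const
    exact fun x hx => pow_eq_zero_iff two_ne_zero |>.mp (h2 hx)
  -- The cosine transform of a compactly supported function extends to an entire function. It
  -- vanishes on (a, ∞), hence everywhere.
  set G : ℂ → ℂ := fun w => ∫ z : I, ((ε * 2 * a * φ (a * z) : ℝ) : ℂ) *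
    Complex.cos (((2 * Real.pi * a * z : ℝ) : ℂ) * w) with hG
  have hGφ : ∀ x : ℝ, G x = φ x := by
    intro x
    have h := cosTransform_restrictTo ha heven (x / a)
    rw [mul_div_cancel₀ _ ha.ne'] at h
    rw [hφ, h, ← integral_const_mul, ← integral_complex_ofReal]
    refine integral_congr_ae (Filter.Eventually.of_forall fun z => ?_)
    simp only
    rw [cosProfile, show 2 * Real.pi * a ^ 2 * (x / a * z) = 2 * Real.pi * a * z * x by field_simp]
    push_cast
    ring
  have hGd : Differentiable ℂ G := by
    refine differentiable_integral_of_continuous (F' := fun w z =>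
      ((ε * 2 * a * φ (a * z) : ℝ) : ℂ) * (-Complex.sin (((2 * Real.pi * a * z : ℝ) : ℂ) * w) *
        (((2 * Real.pi * a * z : ℝ) : ℂ) * 1))) volume ?_ ?_ fun w z => ?_
    · unfold Function.uncurry; fun_prop
    · unfold Function.uncurry; fun_prop
    · exact (((hasDerivAt_id w).const_mul _).ccos).const_mul _
  have hG0 : Set.EqOn G 0 Set.univ := by
    refine AnalyticOnNhd.eqOn_zero_of_preconnected_of_frequently_eq_zero
      (fun z _ => hGd.analyticAt z) isPreconnected_univ (z₀ := ((a + 1 : ℝ) : ℂ)) trivial ?_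
    have ht : Filter.Tendsto (fun x : ℝ => (x : ℂ)) (nhdsWithin (a + 1) {a + 1}ᶜ)
        (nhdsWithin ((a + 1 : ℝ) : ℂ) {((a + 1 : ℝ) : ℂ)}ᶜ) := by
      refine tendsto_nhdsWithin_of_tendsto_nhds_of_eventually_within _
        (Complex.continuous_ofReal.continuousAt.mono_left nhdsWithin_le_nhds) ?_
      filter_upwards [self_mem_nhdsWithin] with x hx
      exact fun h => hx (Complex.ofReal_injective h)
    refine ht.frequently (Filter.Eventually.frequently ?_)
    filter_upwards [mem_nhdsWithin_of_mem_nhds (Ioi_mem_nhds (lt_add_one a))] with x hx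
    rw [hGφ, hout x hx, Complex.ofReal_zero]
  funext x
  have := hG0 (Set.mem_univ (x : ℂ))
  rw [hGφ] at this
  simpa using this

end Injectivity

/-- Only injectivity is needed. A solution f on [0, 1] is extended to ℝ by its own equation; after
rescaling it is an even function covered by `eq_zero_of_eq_cosTransform`. -/
theorem isUnit_one_add_cosKernel {a ε : ℝ} (ha : 0 < a) (hε : ε ^ 2 = 1) :
    IsUnit (1 + Fredholm.integralOp volume (ε • cosKernel a)) := by
  refine Fredholm.isUnit_one_add_integralOp _ _ fun f hf => ?_
  set ψ : ℝ → ℝ := fun x => -ε * ∫ z : I, cosProfile a (x * z) * f z with hψ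
  have hψc : Continuous ψ := by
    have : Continuous fun x => -ε * Fredholm.integralCLM volume ((cosCurve a).curry x * f) := by
      fun_prop
    exact this
  have hψf : ∀ x : I, ψ x = f x := by
    intro x
    have := congrArg (fun h : C(I, ℝ) => h x) hf
    simp only [ContinuousMap.add_apply, Fredholm.integralOp_apply, ContinuousMap.smul_apply,
      cosKernel_apply, ContinuousMap.zero_apply, smul_eq_mul, mul_assoc, integral_const_mul] at this
    simp only [hψ]
    linarith
  have h0 := eq_zero_of_eq_cosTransform (ε := -ε) ha (by rw [neg_sq, hε])
    (φ := fun x => ψ (x / a)) (hψc.comp (continuous_id.div_const a)) ?_ ?_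
  · ext x
    have := congrFun h0 (a * x)
    simp only [mul_div_cancel_left₀ _ ha.ne', hψf] at this
    simpa using this
  · intro x
    simp only [hψ, neg_div, neg_mul]
    congr 2
    simp [cosProfile]
  · intro x
    have h := cosTransform_restrictTo (φ := fun x => ψ (x / a)) ha ?_ (x / a)
    · rw [mul_div_cancel₀ _ ha.ne'] at h
      rw [h]
      simp only [mul_div_cancel_left₀ _ ha.ne', hψf]
      rfl
    · intro x
      simp only [hψ, neg_div, neg_mul]
      congr 2
      simp [cosProfile]

end

/-! ### Dilations, the resolvent equations and the Riccati equation. -/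

noncomputable section

open scoped unitInterval
open Fredholm

/-- The derivative of `cosProfile a`. -/
def cosProfileDeriv (a t : ℝ) : ℝ :=
  -(2 * a * (2 * Real.pi * a ^ 2)) * Real.sin (2 * Real.pi * a ^ 2 * t)

theorem hasDerivAt_cosProfile (a t : ℝ) :
    HasDerivAt (cosProfile a) (cosProfileDeriv a t) t := by
  have h := (((hasDerivAt_id t).const_mul (2 * Real.pi * a ^ 2)).cos).const_mul (2 * a)
  refine h.congr_deriv ?_
  simp only [cosProfileDeriv, id]
  ring

/-- The derivative of `u ↦ cosProfile (exp u) t`, namely the generator `2 t ∂ₜ + 1` of dilations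
applied to `cosProfile`. -/
def cosProfileDot (a t : ℝ) : ℝ := cosProfile a t + 2 * t * cosProfileDeriv a t

theorem hasDerivAt_cosProfile_exp (u t : ℝ) :
    HasDerivAt (fun v => cosProfile (Real.exp v) t) (cosProfileDot (Real.exp u) t) u := by
  have he := Real.hasDerivAt_exp u
  have h := (he.const_mul 2).mul ((((he.pow 2).const_mul (2 * Real.pi)).mul_const t).cos)
  refine h.congr_deriv ?_
  simp only [cosProfileDot, cosProfile, cosProfileDeriv, Pi.pow_apply]
  push_cast
  ring

/-- The kernel of the derivative of `u ↦ cosKernel (exp u)`. -/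
def cosKernelDot (a : ℝ) : C(I × I, ℝ) :=
  ⟨fun p => cosProfileDot a (p.1 * p.2), by
    unfold cosProfileDot cosProfile cosProfileDeriv; fun_prop⟩

/-- The curve `u ↦ cosKernel (exp u)`, uncurried. -/
def cosKernelCurve : C(ℝ × (I × I), ℝ) :=
  ⟨fun q => cosProfile (Real.exp q.1) (q.2.1 * q.2.2), by unfold cosProfile; fun_prop⟩

def cosKernelDotCurve : C(ℝ × (I × I), ℝ) :=
  ⟨fun q => cosProfileDot (Real.exp q.1) (q.2.1 * q.2.2), by
    unfold cosProfileDot cosProfile cosProfileDeriv; fun_prop⟩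

theorem hasDerivAt_cosKernel (u : ℝ) :
    HasDerivAt (fun v => cosKernel (Real.exp v)) (cosKernelDot (Real.exp u)) u :=
  hasDerivAt_curry (F := cosKernelCurve) (F' := cosKernelDotCurve)
    (fun u x => hasDerivAt_cosProfile_exp u (x.1 * x.2)) u

theorem contDiff_cosKernel : ContDiff ℝ 1 fun v => cosKernel (Real.exp v) :=
  contDiff_one_curry (F := cosKernelCurve) (F' := cosKernelDotCurve)
    fun u x => hasDerivAt_cosProfile_exp u (x.1 * x.2)

/-- The column `cosKernel a (·, 1)`. -/
def cosVec (a : ℝ) : C(I, ℝ) := ⟨fun x => cosProfile a x, by unfold cosProfile; fun_prop⟩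

/-- The column `cosKernelDot a (·, 1)`. -/
def cosVecDot (a : ℝ) : C(I, ℝ) :=
  ⟨fun x => cosProfileDot a x, by unfold cosProfileDot cosProfile cosProfileDeriv; fun_prop⟩

def cosVecCurve : C(ℝ × I, ℝ) :=
  ⟨fun q => cosProfile (Real.exp q.1) q.2, by unfold cosProfile; fun_prop⟩

def cosVecDotCurve : C(ℝ × I, ℝ) :=
  ⟨fun q => cosProfileDot (Real.exp q.1) q.2, by
    unfold cosProfileDot cosProfile cosProfileDeriv; fun_prop⟩

theorem hasDerivAt_cosVec (u : ℝ) :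
    HasDerivAt (fun v => cosVec (Real.exp v)) (cosVecDot (Real.exp u)) u :=
  hasDerivAt_curry (F := cosVecCurve) (F' := cosVecDotCurve)
    (fun u x => hasDerivAt_cosProfile_exp u x) u

theorem contDiff_cosVec : ContDiff ℝ 1 fun v => cosVec (Real.exp v) :=
  contDiff_one_curry (F := cosVecCurve) (F' := cosVecDotCurve)
    fun u x => hasDerivAt_cosProfile_exp u x

/-- The derivative in `x` of `cosCurve a (x, z)`. -/
def cosCurveDeriv (a : ℝ) : C(ℝ × I, ℝ) :=
  ⟨fun p => cosProfileDeriv a (p.1 * p.2) * p.2, by unfold cosProfileDeriv; fun_prop⟩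

theorem hasDerivAt_cosCurve (a x : ℝ) :
    HasDerivAt (fun x => (cosCurve a).curry x) ((cosCurveDeriv a).curry x) x := by
  refine hasDerivAt_curry (F := cosCurve a) (F' := cosCurveDeriv a) (fun x z => ?_) x
  exact HasDerivAt.comp x (h₂ := cosProfile a) (h := fun x => x * z)
    (hasDerivAt_cosProfile a (x * z)) (hasDerivAt_mul_const (z : ℝ))

section Resolvent

variable (ε a : ℝ)

/-- The resolvent `(1 + ε K)⁻¹`. -/
def cosResolvent : C(I, ℝ) →L[ℝ] C(I, ℝ) :=
  Ring.inverse (1 + integralOp volume (ε • cosKernel a))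

/-- The solution of `p + ε K p = K (·, 1)`. -/
def cosSol : C(I, ℝ) := cosResolvent ε a (cosVec a)

variable {ε a}

theorem cosResolvent_mul (ha : 0 < a) (hε : ε ^ 2 = 1) :
    cosResolvent ε a * (1 + integralOp volume (ε • cosKernel a)) = 1 :=
  Ring.inverse_mul_cancel _ (isUnit_one_add_cosKernel ha hε)

theorem mul_cosResolvent (ha : 0 < a) (hε : ε ^ 2 = 1) :
    (1 + integralOp volume (ε • cosKernel a)) * cosResolvent ε a = 1 :=
  Ring.mul_inverse_cancel _ (isUnit_one_add_cosKernel ha hε)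

theorem eq_cosResolvent (ha : 0 < a) (hε : ε ^ 2 = 1) {f g : C(I, ℝ)}
    (h : f + ε • integralOp volume (cosKernel a) f = g) : f = cosResolvent ε a g := by
  have h1 := congrArg (fun T : C(I, ℝ) →L[ℝ] C(I, ℝ) => T f) (cosResolvent_mul ha hε)
  have h2 : (1 + integralOp volume (ε • cosKernel a)) f = g := by
    rw [← h, map_smul]; rfl
  simp only [mul_apply_eq_comp, h2] at h1
  exact h1.symm

theorem cosResolvent_add (ha : 0 < a) (hε : ε ^ 2 = 1) (g : C(I, ℝ)) :
    cosResolvent ε a g + ε • integralOp volume (cosKernel a) (cosResolvent ε a g) = g := by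
  have h1 := congrArg (fun T : C(I, ℝ) →L[ℝ] C(I, ℝ) => T g) (mul_cosResolvent ha hε)
  rw [map_smul] at h1
  exact h1

theorem cosSol_add (ha : 0 < a) (hε : ε ^ 2 = 1) :
    cosSol ε a + ε • integralOp volume (cosKernel a) (cosSol ε a) = cosVec a :=
  cosResolvent_add ha hε _

theorem eq_zero_of_add_eq_zero (ha : 0 < a) (hε : ε ^ 2 = 1) {f : C(I, ℝ)}
    (h : f + ε • integralOp volume (cosKernel a) f = 0) : f = 0 := by
  rw [eq_cosResolvent ha hε h, map_zero]

theorem cosKernel_symm (a : ℝ) (s t : I) : cosKernel a (s, t) = cosKernel a (t, s) := by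
  rw [cosKernel_apply, cosKernel_apply, mul_comm]

/-- The symmetry of K passes to its resolvent, on writing f and g as images under 1 + εK. -/
theorem integralCLM_mul_cosResolvent_comm (ha : 0 < a) (hε : ε ^ 2 = 1) (f g : C(I, ℝ)) :
    integralCLM volume (f * cosResolvent ε a g) = integralCLM volume (g * cosResolvent ε a f) := by
  have hf := cosResolvent_add ha hε f
  have hg := cosResolvent_add ha hε g
  set F := cosResolvent ε a f
  set G := cosResolvent ε a g
  have h := integralCLM_mul_integralOp_comm volume (cosKernel_symm a) F G
  rw [← hf, ← hg, add_mul, add_mul, map_add, map_add, smul_mul_assoc, smul_mul_assoc, map_smul,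
    map_smul, mul_comm (integralOp _ _ F), mul_comm (integralOp _ _ G), h, mul_comm F G]

theorem contDiff_cosSol (hε : ε ^ 2 = 1) : ContDiff ℝ 1 fun u => cosSol ε (Real.exp u) := by
  refine contDiff_of_add_clm_apply₂_eq (integralOp (volume : Measure I))
    (contDiff_cosKernel.const_smul ε) contDiff_cosVec (fun u => ?_) fun u =>
      ⟨cosResolvent ε (Real.exp u), fun x => ?_, fun x => ?_⟩
  · rw [map_smul]
    exact cosSol_add (Real.exp_pos u) hε
  · rw [map_smul]
    exact (eq_cosResolvent (Real.exp_pos u) hε rfl).symm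
  · rw [map_smul]
    exact cosResolvent_add (Real.exp_pos u) hε x

/-- The derivative `(2 x ∂ₓ + 1) p` of the solution along the generator of dilations. -/
def cosSolDot (ε a : ℝ) : C(I, ℝ) :=
  cosVecDot a - ε • integralOp volume (cosKernelDot a) (cosSol ε a)

/-- The equation (1 + εK) p = k is differentiated in u. The terms in which p is not differentiated,
moved to the right, form `cosSolDot`. -/
theorem deriv_cosSol_add (hε : ε ^ 2 = 1) (u : ℝ) :
    deriv (fun v => cosSol ε (Real.exp v)) u +
      ε • integralOp volume (cosKernel (Real.exp u)) (deriv (fun v => cosSol ε (Real.exp v)) u) =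
      cosSolDot ε (Real.exp u) := by
  have hp := ((contDiff_cosSol hε).differentiable one_ne_zero u).hasDerivAt
  have hK := hasDerivAt_clm_apply₂ (integralOp (volume : Measure I)) (hasDerivAt_cosKernel u) hp
  have h := hp.add (hK.const_smul ε)
  have h' := h.congr_of_eventuallyEq (f₁ := fun v => cosVec (Real.exp v))
    (Filter.Eventually.of_forall fun v => (cosSol_add (Real.exp_pos v) hε).symm)
  have h'' := h'.unique (hasDerivAt_cosVec u)
  rw [cosSolDot, ← h'']
  simp only [smul_add]
  abel

end Resolvent

/-- Integration by parts for the generator of dilations on `[0, 1]`. -/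
theorem integral_cosProfile_mul_dilation (a x : ℝ) {f f' : ℝ → ℝ}
    (hf : ∀ y, HasDerivAt f (f' y) y) (hf' : Continuous f') :
    ∫ y : I, cosProfile a (x * y) * (f y + 2 * y * f' y) =
      2 * f 1 * cosProfile a x - ∫ y : I, cosProfileDot a (x * y) * f y := by
  have hfc : Continuous f := continuous_iff_continuousAt.mpr fun y => (hf y).continuousAt
  have hc1 : Continuous (cosProfile a) := by unfold cosProfile; fun_prop
  have hc2 : Continuous (cosProfileDeriv a) := by unfold cosProfileDeriv; fun_prop
  have hc3 : Continuous (cosProfileDot a) := by unfold cosProfileDot; fun_prop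
  -- The factor y kills the boundary term at 0; the one at 1 produces 2 * f 1.
  have hd : ∀ y, HasDerivAt (fun y => 2 * y * (cosProfile a (x * y) * f y))
      (cosProfile a (x * y) * (f y + 2 * y * f' y) + cosProfileDot a (x * y) * f y) y := by
    intro y
    have h1 : HasDerivAt (fun y => cosProfile a (x * y)) (cosProfileDeriv a (x * y) * x) y :=
      HasDerivAt.comp y (h₂ := cosProfile a) (h := fun y => x * y)
        (hasDerivAt_cosProfile a (x * y)) (hasDerivAt_const_mul x)
    refine (((hasDerivAt_id y).const_mul 2).mul (h1.mul (hf y))).congr_deriv ?_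
    simp only [cosProfileDot, id, Pi.mul_apply]
    ring
  have h := intervalIntegral.integral_eq_sub_of_hasDerivAt (a := 0) (b := 1) (fun y _ => hd y)
    (Continuous.intervalIntegrable (by fun_prop) _ _)
  rw [intervalIntegral.integral_add (Continuous.intervalIntegrable (by fun_prop) _ _)
    (Continuous.intervalIntegrable (by fun_prop) _ _)] at h
  rw [unitInterval.integral_eq_intervalIntegral
      (fun y => cosProfile a (x * y) * (f y + 2 * y * f' y)),
    unitInterval.integral_eq_intervalIntegral (fun y => cosProfileDot a (x * y) * f y)]
  simp only [mul_one, mul_zero, zero_mul, sub_zero] at h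
  linarith

section Riccati

variable {ε a : ℝ}

theorem cosKernelDot_curry (a : ℝ) (x : I) : (cosKernelDot a).curry x =
    (cosCurve a).curry x + (2 * (x : ℝ)) • (cosCurveDeriv a).curry x := by
  ext z
  simp only [ContinuousMap.curry_apply, ContinuousMap.add_apply, ContinuousMap.smul_apply,
    smul_eq_mul, cosKernelDot, cosCurve, cosCurveDeriv, ContinuousMap.coe_mk, cosProfileDot]
  ring

/-- The equation for p extends it to a smooth f on ℝ, and `cosSolDot` is (2y∂ + 1) f. Integration by
parts moves the generator onto K at the cost of the boundary term 2 p(1) k. -/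
theorem integralOp_cosSolDot (ha : 0 < a) (hε : ε ^ 2 = 1) :
    integralOp volume (cosKernel a) (cosSolDot ε a) =
      (2 * cosSol ε a 1) • cosVec a - integralOp volume (cosKernelDot a) (cosSol ε a) := by
  set p := cosSol ε a with hp
  set f : ℝ → ℝ := fun x => cosProfile a x - ε * integralCLM volume ((cosCurve a).curry x * p)
  set f' : ℝ → ℝ := fun x =>
    cosProfileDeriv a x - ε * integralCLM volume ((cosCurveDeriv a).curry x * p)
  have hf : ∀ y, HasDerivAt f (f' y) y := fun y =>
    (hasDerivAt_cosProfile a y).sub (((integralCLM volume).hasFDerivAt.comp_hasDerivAt y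
      ((hasDerivAt_cosCurve a y).mul_const p)).const_mul ε)
  have hf' : Continuous f' := by
    have : Continuous (cosProfileDeriv a) := by unfold cosProfileDeriv; fun_prop
    fun_prop
  have hfp : ∀ y : I, f y = p y := by
    intro y
    have h := congrArg (fun g : C(I, ℝ) => g y) (cosSol_add ha hε)
    simp only [ContinuousMap.add_apply, ContinuousMap.smul_apply, smul_eq_mul] at h
    have h2 : integralCLM volume ((cosCurve a).curry (y : ℝ) * p) =
        integralOp volume (cosKernel a) p y := rfl
    have h3 : cosVec a y = cosProfile a y := rfl
    simp only [f, h2]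
    linarith
  have hw : ∀ y : I, cosSolDot ε a y = f y + 2 * y * f' y := by
    intro y
    have h2 : integralOp volume (cosKernelDot a) p y =
        integralCLM volume ((cosKernelDot a).curry y * p) := rfl
    simp only [cosSolDot, ContinuousMap.sub_apply, ContinuousMap.smul_apply, smul_eq_mul, ← hp]
    rw [h2, cosKernelDot_curry, add_mul, map_add, smul_mul_assoc, map_smul]
    simp only [f, f', cosVecDot, ContinuousMap.coe_mk, cosProfileDot, smul_eq_mul]
    ring
  ext x
  have h := integral_cosProfile_mul_dilation a x hf hf'
  simp only [ContinuousMap.sub_apply, ContinuousMap.smul_apply, smul_eq_mul, integralOp_apply, hw]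
  have h1 : f 1 = p 1 := hfp 1
  simp only [hfp, h1] at h ⊢
  exact h

/-- The Riccati equation: the derivative of `p₊ - p₋`. -/
theorem deriv_cosSol_sub (u : ℝ) :
    deriv (fun v => cosSol 1 (Real.exp v)) u - deriv (fun v => cosSol (-1) (Real.exp v)) u =
      -(cosSol 1 (Real.exp u) 1 + cosSol (-1) (Real.exp u) 1) •
        (cosSol 1 (Real.exp u) + cosSol (-1) (Real.exp u)) := by
  have ha := Real.exp_pos u
  have h1 : (1 : ℝ) ^ 2 = 1 := one_pow 2
  have h2 : (-1 : ℝ) ^ 2 = 1 := by norm_num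
  have d1 := deriv_cosSol_add h1 u
  have d2 := deriv_cosSol_add h2 u
  have e1 := cosSol_add ha h1
  have e2 := cosSol_add ha h2
  have i1 := integralOp_cosSolDot ha h1
  have i2 := integralOp_cosSolDot ha h2
  rw [← d1] at i1
  rw [← d2] at i2
  simp only [cosSolDot] at d1 d2
  set A := deriv (fun v => cosSol 1 (Real.exp v)) u
  set B := deriv (fun v => cosSol (-1) (Real.exp v)) u
  set p := cosSol 1 (Real.exp u)
  set q := cosSol (-1) (Real.exp u)
  set k := cosVec (Real.exp u)
  set T := integralOp volume (cosKernel (Real.exp u))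
  set T' := integralOp volume (cosKernelDot (Real.exp u))
  have hTp := congrArg T e1
  have hTq := congrArg T e2
  simp only [map_add, map_smul] at i1 i2 hTp hTq
  -- In 1 - K² the K̇ terms cancel: (1 - K²) A = k̇ - 2 p(1) k and (1 - K²) B = k̇ + 2 q(1) k, while
  -- (1 - K²)(p + q) = 2k. So (1 + K)(1 - K) Y = 0, and injectivity is used twice.
  set Y := A - B + (p 1 + q 1) • (p + q) with hY
  have hz : Y + (-1 : ℝ) • T Y = 0 := by
    refine eq_zero_of_add_eq_zero ha h1 ?_
    simp only [hY, map_add, map_sub, map_smul, smul_add, smul_sub]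
    linear_combination (norm := module) d1 - d2 - i1 - i2 + (p 1 + q 1) • (e1 + e2 - hTp + hTq)
  have := eq_zero_of_add_eq_zero ha h2 hz
  linear_combination (norm := module) this

end Riccati

end

/-! ### Logarithmic derivatives of the three determinants. -/

noncomputable section

open scoped unitInterval
open Fredholm

section LogDeriv

variable {ε a : ℝ}

theorem column_smul_cosKernel (ε a : ℝ) (t : I) :
    column (ε • cosKernel a) t = ε • (cosCurve a).curry (t : ℝ) := by
  ext z
  simp only [column_apply, ContinuousMap.smul_apply, ContinuousMap.curry_apply, cosKernel_apply,
    cosCurve_apply, mul_comm]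

/-- With r the kernel of εK(1 + εK)⁻¹, the integrand is the derivative of x r(x, x), which is `G`
below. The dilation generator supplies 2x∂ₓ in one variable only, and the symmetry of the resolvent
matches it with the derivative along the diagonal. -/
theorem integral_cosResolvent_diagonal (ha : 0 < a) (hε : ε ^ 2 = 1) :
    ∫ t : I, ((ε • cosKernelDot a) (t, t) - integralCLM volume ((ε • cosKernelDot a).curry t *
      cosResolvent ε a (column (ε • cosKernel a) t))) = ε * cosSol ε a 1 := by
  set κ : ℝ → C(I, ℝ) := fun x => (cosCurve a).curry x with hκ
  set κ' : ℝ → C(I, ℝ) := fun x => (cosCurveDeriv a).curry x with hκ'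
  set R := cosResolvent ε a with hR
  have hc1 : Continuous (cosProfile a) := by unfold cosProfile; fun_prop
  have hc2 : Continuous (cosProfileDeriv a) := by unfold cosProfileDeriv; fun_prop
  have hκc : Continuous κ := (cosCurve a).curry.continuous
  have hκc' : Continuous κ' := (cosCurveDeriv a).curry.continuous
  set G : ℝ → ℝ := fun x => x * (ε * cosProfile a (x * x) - integralCLM volume (κ x * R (κ x)))
  set G' : ℝ → ℝ := fun x => ε * (cosProfile a (x * x) + 2 * (x * x) * cosProfileDeriv a (x * x)) -
    integralCLM volume ((κ x + (2 * x) • κ' x) * R (κ x)) with hG'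
  have hG : ∀ x, HasDerivAt G (G' x) x := by
    intro x
    have d1 : HasDerivAt (fun x => cosProfile a (x * x)) (cosProfileDeriv a (x * x) * (x + x)) x :=
      HasDerivAt.comp x (h₂ := cosProfile a) (h := fun x => x * x)
        (hasDerivAt_cosProfile a (x * x))
        (((hasDerivAt_id x).mul (hasDerivAt_id x)).congr_deriv (by simp))
    have d2 : HasDerivAt κ (κ' x) x := hasDerivAt_cosCurve a x
    have d3 : HasDerivAt (fun x => R (κ x)) (R (κ' x)) x := R.hasFDerivAt.comp_hasDerivAt x d2
    have d4 : HasDerivAt (fun x => integralCLM volume (κ x * R (κ x)))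
        (integralCLM volume (κ' x * R (κ x) + κ x * R (κ' x))) x :=
      (integralCLM volume).hasFDerivAt.comp_hasDerivAt x (d2.mul d3)
    refine ((hasDerivAt_id x).mul ((d1.const_mul ε).sub d4)).congr_deriv ?_
    rw [map_add, integralCLM_mul_cosResolvent_comm ha hε (κ x) (κ' x)]
    simp only [hG', add_mul, map_add, smul_mul_assoc, map_smul, smul_eq_mul, id, Pi.sub_apply, ← hR]
    ring
  have hG'c : Continuous G' := by fun_prop
  have h := intervalIntegral.integral_eq_sub_of_hasDerivAt (a := 0) (b := 1) (fun x _ => hG x)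
    (hG'c.intervalIntegrable _ _)
  have hval : G 1 = ε * cosSol ε a 1 := by
    have h1 : κ 1 = cosVec a := by
      ext z; simp [hκ, cosCurve_apply, cosVec]
    have h2 : integralCLM volume (cosVec a * cosSol ε a) =
        integralOp volume (cosKernel a) (cosSol ε a) 1 := by
      simp [integralOp_apply, cosKernel_apply, cosVec]
    have h3 := congrArg (fun g : C(I, ℝ) => g 1) (cosSol_add ha hε)
    simp only [ContinuousMap.add_apply, ContinuousMap.smul_apply, smul_eq_mul] at h3
    have h4 : cosVec a 1 = cosProfile a (1 * 1) := by simp [cosVec]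
    simp only [G, one_mul, h1] at h4 ⊢
    have h5 : R (cosVec a) = cosSol ε a := rfl
    rw [h5, h2, ← h4, ← h3]
    linear_combination integralOp volume (cosKernel a) (cosSol ε a) 1 * hε
  have hG0 : G 0 = 0 := by simp [G]
  rw [hval, hG0, sub_zero, ← unitInterval.integral_eq_intervalIntegral] at h
  rw [← h]
  refine integral_congr_ae (Filter.Eventually.of_forall fun t => ?_)
  have e1 : (ε • cosKernelDot a).curry t = ε • (κ t + (2 * (t : ℝ)) • κ' t) := by
    rw [hκ, hκ', ← cosKernelDot_curry]; rfl
  simp only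
  rw [e1, column_smul_cosKernel, map_smul, smul_mul_smul_comm, map_smul, ← pow_two, hε, one_smul]
  rfl

/-- The logarithmic derivative of `det (1 ± F_a⁺)`. -/
theorem hasDerivAt_det_cosKernel (hε : ε ^ 2 = 1) (u : ℝ) :
    HasDerivAt (fun v => det volume (ε • cosKernel (Real.exp v)))
      (det volume (ε • cosKernel (Real.exp u)) * (ε * cosSol ε (Real.exp u) 1)) u := by
  have ha := Real.exp_pos u
  rw [← integral_cosResolvent_diagonal ha hε]
  exact hasDerivAt_det_comp volume ((hasDerivAt_cosKernel u).const_smul ε)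
    (cosResolvent_mul ha hε)

end LogDeriv

section Dirichlet

theorem hasDerivAt_mul_sinc (t s : ℝ) :
    HasDerivAt (fun s => s * Real.sinc (s * t)) (Real.cos (s * t)) s := by
  by_cases ht : t = 0
  · subst ht
    simpa using hasDerivAt_id' s
  · have h : (fun s => s * Real.sinc (s * t)) = fun s => Real.sin (s * t) / t := by
      funext s
      by_cases hs : s = 0
      · simp [hs]
      · rw [Real.sinc_of_ne_zero (mul_ne_zero hs ht)]
        field_simp
    rw [h]
    refine (((hasDerivAt_mul_const t).sin).div_const t).congr_deriv ?_
    field_simp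

/-- Differentiation in s turns each sinc term into a cosine, and the addition formulas turn the sum
of cosines into a product. Hence D has a derivative of rank one. -/
theorem hasDerivAt_evenDirichletKernel (u x y : ℝ) :
    HasDerivAt (fun v => evenDirichletKernel (2 * Real.pi * Real.exp v ^ 2) x y)
      (2 * (cosProfile (Real.exp u) x * cosProfile (Real.exp u) y)) u := by
  have hs : HasDerivAt (fun v => 2 * Real.pi * Real.exp v ^ 2) (4 * Real.pi * Real.exp u ^ 2) u := by
    refine (((Real.hasDerivAt_exp u).pow 2).const_mul (2 * Real.pi)).congr_deriv ?_
    push_cast; ring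
  have h1 := HasDerivAt.comp u (h₂ := fun s => s * Real.sinc (s * (x - y)))
    (hasDerivAt_mul_sinc (x - y) _) hs
  have h2 := HasDerivAt.comp u (h₂ := fun s => s * Real.sinc (s * (x + y)))
    (hasDerivAt_mul_sinc (x + y) _) hs
  have h := ((h1.add h2).const_mul (1 / Real.pi)).congr_of_eventuallyEq
    (f₁ := fun v => evenDirichletKernel (2 * Real.pi * Real.exp v ^ 2) x y)
    (Filter.Eventually.of_forall fun v => by
      simp only [evenDirichletKernel, Pi.add_apply, Function.comp_apply]; ring)
  refine h.congr_deriv ?_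
  have e1 : 2 * Real.pi * Real.exp u ^ 2 * (x - y) =
    2 * Real.pi * Real.exp u ^ 2 * x - 2 * Real.pi * Real.exp u ^ 2 * y := by ring
  have e2 : 2 * Real.pi * Real.exp u ^ 2 * (x + y) =
    2 * Real.pi * Real.exp u ^ 2 * x + 2 * Real.pi * Real.exp u ^ 2 * y := by ring
  rw [e1, e2, Real.cos_sub, Real.cos_add, cosProfile, cosProfile]
  have := Real.pi_ne_zero
  field_simp
  ring

/-- The even Dirichlet kernel on the unit square. -/
def dirichletKernel (a : ℝ) : C(I × I, ℝ) :=
  ⟨fun p => evenDirichletKernel (2 * Real.pi * a ^ 2) p.1 p.2, by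
    unfold evenDirichletKernel
    have := Real.continuous_sinc
    fun_prop⟩

/-- The curve `u ↦ dirichletKernel (exp u)`, uncurried. -/
def dirichletCurve : C(ℝ × (I × I), ℝ) :=
  ⟨fun q => evenDirichletKernel (2 * Real.pi * Real.exp q.1 ^ 2) q.2.1 q.2.2, by
    unfold evenDirichletKernel
    have := Real.continuous_sinc
    fun_prop⟩

/-- The derivative of `dirichletKernel (exp u)` has rank one. -/
def dirichletDotCurve : C(ℝ × (I × I), ℝ) :=
  ⟨fun q => 2 * (cosProfile (Real.exp q.1) q.2.1 * cosProfile (Real.exp q.1) q.2.2), by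
    unfold cosProfile; fun_prop⟩

theorem hasDerivAt_dirichletKernel (u : ℝ) :
    HasDerivAt (fun v => dirichletKernel (Real.exp v)) (dirichletDotCurve.curry u) u :=
  hasDerivAt_curry (F := dirichletCurve) (F' := dirichletDotCurve)
    (fun u x => hasDerivAt_evenDirichletKernel u x.1 x.2) u

theorem dirichletKernel_apply (a : ℝ) (x y : I) :
    dirichletKernel a (x, y) = ∫ z : I, cosKernel a (x, z) * cosKernel a (z, y) := by
  have h := integral_cos_mul_cos_eq_evenDirichletKernel a x y
  rw [← unitInterval.integral_eq_intervalIntegral] at h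
  refine h.symm.trans (integral_congr_ae (Filter.Eventually.of_forall fun z => ?_))
  simp only [cosKernel_apply, cosProfile, mul_assoc]

theorem dirichletKernel_symm (a : ℝ) (s t : I) :
    dirichletKernel a (s, t) = dirichletKernel a (t, s) := by
  rw [dirichletKernel_apply, dirichletKernel_apply]
  refine integral_congr_ae (Filter.Eventually.of_forall fun z => ?_)
  simp only [cosKernel_symm a s, cosKernel_symm a z t, mul_comm]

theorem integralOp_dirichletKernel (a : ℝ) (f : C(I, ℝ)) :
    integralOp volume (dirichletKernel a) f =
      integralOp volume (cosKernel a) (integralOp volume (cosKernel a) f) := by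
  ext x
  simp only [integralOp_apply, dirichletKernel_apply, ← integral_const_mul, ← integral_mul_const]
  rw [integral_integral_swap]
  · refine integral_congr_ae (Filter.Eventually.of_forall fun z => ?_)
    refine integral_congr_ae (Filter.Eventually.of_forall fun s => ?_)
    simp only [mul_assoc]
  · exact integrable_of_continuous _ (by fun_prop)

variable {a : ℝ}

/-- The resolvent `(1 - D)⁻¹ = (1 + K)⁻¹ (1 - K)⁻¹`. -/
def dirichletResolvent (a : ℝ) : C(I, ℝ) →L[ℝ] C(I, ℝ) := cosResolvent 1 a * cosResolvent (-1) a

theorem dirichletResolvent_mul (ha : 0 < a) :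
    dirichletResolvent a * (1 + integralOp volume (-dirichletKernel a)) = 1 := by
  have h1 := cosResolvent_mul (ε := 1) ha (one_pow 2)
  have h2 := cosResolvent_mul (ε := -1) ha (by norm_num)
  have h3 : (1 + integralOp volume (-dirichletKernel a)) =
      (1 + integralOp volume ((-1 : ℝ) • cosKernel a)) *
        (1 + integralOp volume ((1 : ℝ) • cosKernel a)) := by
    ext1 f
    have h := integralOp_dirichletKernel a f
    rw [map_smul, map_smul, map_neg]
    show f + -(integralOp volume (dirichletKernel a) f) =
      (f + (1 : ℝ) • integralOp volume (cosKernel a) f) + (-1 : ℝ) • integralOp volume (cosKernel a)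
        (f + (1 : ℝ) • integralOp volume (cosKernel a) f)
    rw [h, map_add, map_smul]
    module
  rw [h3, dirichletResolvent, mul_assoc, ← mul_assoc (cosResolvent (-1) a), h2, one_mul, h1]

/-- Partial fractions: (1 - K²)⁻¹ is the mean of (1 + K)⁻¹ and (1 - K)⁻¹. -/
theorem dirichletResolvent_cosVec (ha : 0 < a) :
    dirichletResolvent a (cosVec a) = (1 / 2 : ℝ) • (cosSol 1 a + cosSol (-1) a) := by
  have e1 := cosSol_add (ε := 1) ha (one_pow 2)
  have e2 := cosSol_add (ε := -1) ha (by norm_num)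
  refine (eq_cosResolvent (ε := 1) ha (one_pow 2) ?_).symm
  show _ = cosSol (-1) a
  have h1 := congrArg (integralOp volume (cosKernel a)) e1
  have h2 := congrArg (integralOp volume (cosKernel a)) e2
  have hz : (1 / 2 : ℝ) • (cosSol 1 a + cosSol (-1) a) + (1 : ℝ) • integralOp volume (cosKernel a)
      ((1 / 2 : ℝ) • (cosSol 1 a + cosSol (-1) a)) - cosSol (-1) a = 0 := by
    rw [map_smul, map_add]
    linear_combination (norm := module) (1 / 2 : ℝ) • e1 - (1 / 2 : ℝ) • e2
  exact sub_eq_zero.mp hz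

theorem integralCLM_mul_dirichletResolvent_comm (ha : 0 < a) (f g : C(I, ℝ)) :
    integralCLM volume (f * dirichletResolvent a g) =
      integralCLM volume (g * dirichletResolvent a f) := by
  have hcomm : ∀ h, cosResolvent 1 a (cosResolvent (-1) a h) =
      cosResolvent (-1) a (cosResolvent 1 a h) := by
    intro h
    have e1 := cosResolvent_add (ε := 1) ha (one_pow 2) h
    have e2 := cosResolvent_add (ε := -1) ha (by norm_num) (cosResolvent 1 a h)
    refine (eq_cosResolvent (ε := 1) ha (one_pow 2) ?_).symm
    refine eq_cosResolvent (ε := -1) ha (by norm_num) ?_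
    have h2 := congrArg (integralOp volume (cosKernel a)) e2
    simp only [map_add, map_smul] at h2 ⊢
    linear_combination (norm := module) e1 + e2 + h2
  show integralCLM volume (f * cosResolvent 1 a (cosResolvent (-1) a g)) =
    integralCLM volume (g * cosResolvent 1 a (cosResolvent (-1) a f))
  rw [integralCLM_mul_cosResolvent_comm ha (one_pow 2), mul_comm,
    integralCLM_mul_cosResolvent_comm ha (by norm_num), hcomm]

/-- The derivative of -D is -2 k ⊗ k, so the trace is -2 ∫ k (1 - D)⁻¹k = -∫ k (p + q) = -K(p +
q)(1). The equations Kp = k - p and Kq = q - k evaluate it. -/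
theorem integral_dirichletResolvent_diagonal (u : ℝ) :
    ∫ t : I, ((-dirichletDotCurve.curry u) (t, t) -
      integralCLM volume ((-dirichletDotCurve.curry u).curry t *
        dirichletResolvent (Real.exp u) (column (-dirichletKernel (Real.exp u)) t))) =
      cosSol 1 (Real.exp u) 1 - cosSol (-1) (Real.exp u) 1 := by
  set a := Real.exp u with hau
  have ha : 0 < a := Real.exp_pos u
  set k := cosVec a
  set S := dirichletResolvent a
  set p := cosSol 1 a
  set q := cosSol (-1) a
  have hSk : S k = (1 / 2 : ℝ) • (p + q) := dirichletResolvent_cosVec ha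
  have hS : S k - integralOp volume (dirichletKernel a) (S k) = k := by
    have e1 := cosSol_add (ε := 1) ha (one_pow 2)
    have e2 := cosSol_add (ε := -1) ha (by norm_num)
    have h1 := congrArg (integralOp volume (cosKernel a)) e1
    have h2 := congrArg (integralOp volume (cosKernel a)) e2
    rw [integralOp_dirichletKernel, hSk]
    simp only [map_add, map_smul] at h1 h2 ⊢
    linear_combination (norm := module) (1 / 2 : ℝ) • (e1 + e2 - h1 + h2)
  have hint : ∀ t : I, (-dirichletDotCurve.curry u) (t, t) -
      integralCLM volume ((-dirichletDotCurve.curry u).curry t *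
        S (column (-dirichletKernel a) t)) = (-2 : ℝ) * (k t * S k t) := by
    intro t
    have c1 : (-dirichletDotCurve.curry u).curry t = (-2 * k t) • k := by
      ext z
      simp only [ContinuousMap.curry_apply, ContinuousMap.neg_apply, ContinuousMap.smul_apply,
        smul_eq_mul]
      show -(2 * (cosProfile (Real.exp u) t * cosProfile (Real.exp u) z)) =
        -2 * cosProfile a t * cosProfile a z
      rw [hau]; ring
    have c2 : column (-dirichletKernel a) t = -column (dirichletKernel a) t := rfl
    have c3 : (-dirichletDotCurve.curry u) (t, t) = -2 * k t * k t :=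
      congrArg (fun g : C(I, ℝ) => g t) c1
    have c4 : integralCLM volume (k * S (column (dirichletKernel a) t)) =
        integralOp volume (dirichletKernel a) (S k) t := by
      rw [integralCLM_mul_dirichletResolvent_comm ha, integralOp_apply, integralCLM_apply]
      refine integral_congr_ae (Filter.Eventually.of_forall fun z => ?_)
      simp only [ContinuousMap.mul_apply, column_apply, dirichletKernel_symm a t]
      rfl
    have c5 := congrArg (fun g : C(I, ℝ) => g t) hS
    simp only [ContinuousMap.sub_apply] at c5
    rw [c1, c2, c3, map_neg, mul_neg, map_neg, smul_mul_assoc, map_smul, c4, smul_eq_mul]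
    linear_combination (2 * k t) * c5
  simp_rw [hint]
  have e1 := congrArg (fun g : C(I, ℝ) => g 1) (cosSol_add (ε := 1) ha (one_pow 2))
  have e2 := congrArg (fun g : C(I, ℝ) => g 1) (cosSol_add (ε := -1) ha (by norm_num))
  have hK : ∀ f : C(I, ℝ), integralOp volume (cosKernel a) f 1 = ∫ t, k t * f t := by
    intro f
    simp [integralOp_apply, cosKernel_apply, k, cosVec]
  have hpq : ∫ t, -2 * (k t * S k t) = -(integralOp volume (cosKernel a) (p + q) 1) := by
    rw [hK, ← integral_neg]
    refine integral_congr_ae (Filter.Eventually.of_forall fun t => ?_)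
    simp only [hSk, ContinuousMap.smul_apply, smul_eq_mul]
    ring
  rw [hpq, map_add, ContinuousMap.add_apply]
  simp only [ContinuousMap.add_apply, ContinuousMap.smul_apply, smul_eq_mul] at e1 e2
  linarith

/-- The logarithmic derivative of `det (1 - D_a⁺)`. -/
theorem hasDerivAt_det_dirichletKernel (u : ℝ) :
    HasDerivAt (fun v => det volume (-dirichletKernel (Real.exp v)))
      (det volume (-dirichletKernel (Real.exp u)) *
        (cosSol 1 (Real.exp u) 1 - cosSol (-1) (Real.exp u) 1)) u := by
  rw [← integral_dirichletResolvent_diagonal u]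
  exact hasDerivAt_det_comp volume (hasDerivAt_dirichletKernel u).neg
    (dirichletResolvent_mul (Real.exp_pos u))

end Dirichlet

/-! ### Positivity, regularity and second derivatives. -/

section Logarithm

/-- A solution of `D' = D g` tending to `1` at `-∞` is positive, and `g` is the derivative of its
logarithm. -/
theorem pos_of_hasDerivAt_mul {D g : ℝ → ℝ} (hD : ∀ u, HasDerivAt D (D u * g u) u)
    (hg : Continuous g) (hlim : Filter.Tendsto D Filter.atBot (nhds 1)) (u : ℝ) : 0 < D u := by
  set P : ℝ → ℝ := fun v => ∫ w in (0 : ℝ)..v, g w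
  have hP : ∀ v, HasDerivAt P (g v) v := fun v => (hg.integral_hasStrictDerivAt 0 v).hasDerivAt
  -- D exp (-P) is constant, and the limit at -∞ makes it positive at some point.
  have hc : ∀ v, HasDerivAt (fun v => D v * Real.exp (-P v)) 0 v := fun v =>
    ((hD v).mul (hP v).neg.exp).congr_deriv (by simp only [Pi.neg_apply]; ring)
  have hconst : ∀ v w, D v * Real.exp (-P v) = D w * Real.exp (-P w) :=
    is_const_of_deriv_eq_zero (fun v => (hc v).differentiableAt) fun v => (hc v).deriv
  obtain ⟨v, hv⟩ := (hlim.eventually (lt_mem_nhds one_pos)).exists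
  have h := hconst u v
  have hpos : 0 < D u * Real.exp (-P u) := by rw [h]; exact mul_pos hv (Real.exp_pos _)
  exact pos_of_mul_pos_left hpos (Real.exp_pos _).le

theorem hasDerivAt_log_of_mul {D g : ℝ → ℝ} (hD : ∀ u, HasDerivAt D (D u * g u) u)
    (hpos : ∀ u, 0 < D u) (u : ℝ) : HasDerivAt (fun v => Real.log (D v)) (g u) u :=
  ((hD u).log (hpos u).ne').congr_deriv (mul_div_cancel_left₀ _ (hpos u).ne')

theorem contDiff_two_of_hasDerivAt {f g : ℝ → ℝ} (hf : ∀ u, HasDerivAt f (g u) u)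
    (hg : ContDiff ℝ 1 g) : ContDiff ℝ 2 f := by
  rw [show (2 : WithTop ℕ∞) = 1 + 1 from (one_add_one_eq_two).symm, contDiff_succ_iff_deriv]
  refine ⟨fun u => (hf u).differentiableAt, by simp, ?_⟩
  rwa [funext fun u => (hf u).deriv]

theorem iteratedDeriv_two_of_hasDerivAt {f g : ℝ → ℝ} (hf : ∀ u, HasDerivAt f (g u) u) (u : ℝ) :
    iteratedDeriv 2 f u = deriv g u := by
  rw [iteratedDeriv_succ, iteratedDeriv_one, funext fun u => (hf u).deriv]

/-- The kernel is continuous up to a = 0, where it vanishes and the determinant is 1. -/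
theorem tendsto_cosKernel (ε : ℝ) :
    Filter.Tendsto (fun u => det volume (ε • cosKernel (Real.exp u))) Filter.atBot (nhds 1) := by
  set F : C(ℝ × (I × I), ℝ) := ⟨fun q => cosProfile q.1 (q.2.1 * q.2.2), by
    unfold cosProfile; fun_prop⟩ with hF
  have hc : Continuous fun a => det volume (ε • F.curry a) :=
    (continuous_det volume).comp (F.curry.continuous.const_smul ε)
  have h0 : F.curry 0 = 0 := by ext p; simp [hF, cosProfile]
  have h := (hc.tendsto 0).comp Real.tendsto_exp_atBot
  rw [h0, smul_zero, det_zero] at h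
  exact h

theorem tendsto_dirichletKernel :
    Filter.Tendsto (fun u => det volume (-dirichletKernel (Real.exp u))) Filter.atBot (nhds 1) := by
  set F : C(ℝ × (I × I), ℝ) :=
    ⟨fun q => evenDirichletKernel (2 * Real.pi * q.1 ^ 2) q.2.1 q.2.2, by
      unfold evenDirichletKernel
      have := Real.continuous_sinc
      fun_prop⟩ with hF
  have hc : Continuous fun a => det volume (-F.curry a) :=
    (continuous_det volume).comp F.curry.continuous.neg
  have h0 : F.curry 0 = 0 := by ext p; simp [hF, evenDirichletKernel]
  have h := (hc.tendsto 0).comp Real.tendsto_exp_atBot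
  rw [h0, neg_zero, det_zero] at h
  exact h

theorem contDiff_cosSol_one {ε : ℝ} (hε : ε ^ 2 = 1) :
    ContDiff ℝ 1 fun u => cosSol ε (Real.exp u) 1 :=
  (contDiff_cosSol hε).continuousLinearMap_comp (ContinuousMap.evalCLM ℝ (1 : I) : C(I, ℝ) →L[ℝ] ℝ)

theorem deriv_cosSol_one {ε : ℝ} (hε : ε ^ 2 = 1) (u : ℝ) :
    deriv (fun v => cosSol ε (Real.exp v) 1) u = deriv (fun v => cosSol ε (Real.exp v)) u 1 :=
  (HasFDerivAt.comp_hasDerivAt u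
    (ContinuousMap.evalCLM ℝ (1 : I) : C(I, ℝ) →L[ℝ] ℝ).hasFDerivAt
    ((contDiff_cosSol hε).differentiable one_ne_zero u).hasDerivAt).deriv

theorem deriv_cosSol_one_sub (u : ℝ) :
    deriv (fun v => cosSol 1 (Real.exp v) 1) u - deriv (fun v => cosSol (-1) (Real.exp v) 1) u =
      -(cosSol 1 (Real.exp u) 1 + cosSol (-1) (Real.exp u) 1) ^ 2 := by
  rw [deriv_cosSol_one (one_pow 2), deriv_cosSol_one (by norm_num), ← ContinuousMap.sub_apply,
    deriv_cosSol_sub]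
  simp only [ContinuousMap.smul_apply, ContinuousMap.add_apply, smul_eq_mul]
  ring

end Logarithm

end

/-! ### Transfer to the original determinants and to φ_a^±. -/

noncomputable section

open scoped unitInterval
open Fredholm

section Transfer

/-- The determinant of the kernel on the unit interval as a Fredholm determinant on `ℝ`. -/
theorem fredholmDet_restrict_Icc (k : ℝ → ℝ → ℝ) (K : C(I × I, ℝ))
    (hK : ∀ x y : I, K (x, y) = k x y) :
    fredholmDet (volume.restrict (Set.Icc 0 1)) k = det volume K := by
  unfold fredholmDet Fredholm.det detIntegral
  congr 1
  funext n
  congr 1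
  have h := measurePreserving_pi (fun _ : Fin n => (volume : Measure I))
    (fun _ : Fin n => (volume : Measure ℝ).restrict (Set.Icc 0 1))
    (fun _ => unitInterval.measurePreserving_coe)
  have he : MeasurableEmbedding fun (x : Fin n → I) i => (x i : ℝ) :=
    Topology.IsClosedEmbedding.measurableEmbedding
      (Topology.IsClosedEmbedding.piMap fun _ => isClosed_Icc.isClosedEmbedding_subtypeVal)
  rw [← h.integral_comp he]
  simp only [hK]

theorem Measure.pi_const_smul {n : ℕ} (c : ENNReal) (hc : c ≠ ⊤) (ν : Measure ℝ)
    [IsFiniteMeasure ν] :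
    Measure.pi (fun _ : Fin n => c • ν) = c ^ n • Measure.pi fun _ => ν := by
  have : IsFiniteMeasure (c • ν) := ν.smul_finite hc
  refine Measure.pi_eq fun s _ => ?_
  simp [Measure.pi_pi, Finset.prod_mul_distrib]

/-- Folding [-a, a] onto [0, 1] doubles the measure and rescales it by a. This is the origin of the
factor 2a in `cosProfile`. -/
theorem measurePreserving_abs_div {a : ℝ} (ha : 0 < a) :
    MeasurePreserving (fun x => |x| / a) (volume.restrict (Set.Icc (-a) a))
      (ENNReal.ofReal (2 * a) • volume.restrict (Set.Icc 0 1)) := by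
  have hm : Measurable fun x : ℝ => |x| / a := by fun_prop
  refine ⟨hm, ?_⟩
  have : IsFiniteMeasure (ENNReal.ofReal (2 * a) • (volume : Measure ℝ).restrict (Set.Icc 0 1)) :=
    Measure.smul_finite _ ENNReal.ofReal_ne_top
  refine Measure.ext_of_Iic _ _ fun t => ?_
  rw [Measure.map_apply hm measurableSet_Iic, Measure.restrict_apply (hm measurableSet_Iic),
    Measure.smul_apply, Measure.restrict_apply measurableSet_Iic]
  have h1 : (fun x : ℝ => |x| / a) ⁻¹' Set.Iic t ∩ Set.Icc (-a) a =
      Set.Icc (-(a * min t 1)) (a * min t 1) := by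
    ext x
    simp only [Set.mem_inter_iff, Set.mem_preimage, Set.mem_Iic, ← abs_le, Set.mem_Icc]
    rw [div_le_iff₀ ha, mul_min_of_nonneg _ _ ha.le, le_min_iff, mul_one, mul_comm t]
  have h2 : Set.Iic t ∩ Set.Icc 0 1 = Set.Icc 0 (min t 1) := by
    ext x
    simp only [Set.mem_inter_iff, Set.mem_Iic, Set.mem_Icc, le_min_iff]
    tauto
  rw [h1, h2, Real.volume_Icc, Real.volume_Icc, smul_eq_mul,
    ← ENNReal.ofReal_mul (by positivity)]
  congr 1
  ring

/-- The cosine kernel depends only on |x| and |y|, so each integral folds onto the unit cube. The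
factor (2a) ^ n arises on one side from the measure, on the other from the n rows. -/
theorem fredholmDet_truncCosKernel {a : ℝ} (ha : 0 < a) (ε : ℝ) :
    fredholmDet (volume.restrict (Set.Icc (-a) a)) (fun x y => ε * truncCosKernel x y) =
      det volume (ε • cosKernel a) := by
  rw [← fredholmDet_restrict_Icc (fun x y => ε * cosProfile a (x * y)) (ε • cosKernel a)
    fun x y => rfl]
  unfold fredholmDet
  congr 1
  funext n
  congr 1
  have h := measurePreserving_pi (fun _ : Fin n => (volume : Measure ℝ).restrict (Set.Icc (-a) a))
    (fun _ : Fin n => ENNReal.ofReal (2 * a) • (volume : Measure ℝ).restrict (Set.Icc 0 1))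
    (hν := fun _ => by
      have : IsFiniteMeasure
        (ENNReal.ofReal (2 * a) • (volume : Measure ℝ).restrict (Set.Icc 0 1)) :=
          Measure.smul_finite _ ENNReal.ofReal_ne_top
      infer_instance)
    (fun _ => measurePreserving_abs_div ha)
  set G : (Fin n → ℝ) → ℝ := fun x => (Matrix.of fun i j : Fin n =>
    ε * Real.cos (2 * Real.pi * a ^ 2 * (x i * x j))).det with hG
  have hGc : Continuous G := Continuous.matrix_det (continuous_matrix fun i j => by
    simp only [Matrix.of_apply]; fun_prop)
  have h1 : ∀ x : Fin n → ℝ, (Matrix.of fun i j : Fin n => ε * truncCosKernel (x i) (x j)).det =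
      G fun i => |x i| / a := by
    intro x
    simp only [hG, truncCosKernel]
    congr 3
    funext i j
    rw [← Real.cos_abs (2 * Real.pi * x i * x j)]
    congr 2
    rw [abs_mul, abs_mul, abs_of_pos Real.two_pi_pos]
    field_simp
  have h2 : ∀ x : Fin n → ℝ, (Matrix.of fun i j : Fin n => ε * cosProfile a (x i * x j)).det =
      (2 * a) ^ n * G x := by
    intro x
    have : (Matrix.of fun i j : Fin n => ε * cosProfile a (x i * x j)) = (2 * a) •
        Matrix.of fun i j : Fin n => ε * Real.cos (2 * Real.pi * a ^ 2 * (x i * x j)) := by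
      ext i j
      simp only [Matrix.of_apply, Matrix.smul_apply, smul_eq_mul, cosProfile]
      ring
    rw [this, Matrix.det_smul, Fintype.card_fin]
  simp_rw [h1, h2]
  rw [integral_const_mul, ← integral_map h.measurable.aemeasurable hGc.aestronglyMeasurable,
    h.map_eq, Measure.pi_const_smul _ ENNReal.ofReal_ne_top, integral_smul_measure]
  rw [ENNReal.toReal_pow, ENNReal.toReal_ofReal (by positivity), smul_eq_mul]

theorem detOneAddF_eq {a : ℝ} (ha : 0 < a) : detOneAddF a = det volume ((1 : ℝ) • cosKernel a) := by
  rw [← fredholmDet_truncCosKernel ha, detOneAddF]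
  simp only [one_mul]

theorem detOneSubF_eq {a : ℝ} (ha : 0 < a) :
    detOneSubF a = det volume ((-1 : ℝ) • cosKernel a) := by
  rw [← fredholmDet_truncCosKernel ha, detOneSubF]
  simp only [neg_mul, one_mul]

theorem detOneSubD_eq (a : ℝ) : detOneSubD a = det volume (-dirichletKernel a) := by
  rw [detOneSubD, Measure.restrict_congr_set Ioo_ae_eq_Icc]
  exact fredholmDet_restrict_Icc _ _ fun x y => rfl

end Transfer

section Phi

variable {ε a : ℝ}

/-- The function `φ_a^±`. -/
def phiSol (ε a x : ℝ) : ℝ :=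
  2 * Real.cos (2 * Real.pi * a * x) -
    ε * (a⁻¹ * integralCLM volume ((cosCurve a).curry (x / a) * cosSol ε a))

theorem cosTransform_neg (f : ℝ → ℝ) (x : ℝ) : cosTransform f (-x) = cosTransform f x := by
  simp only [cosTransform, mul_neg, Real.cos_neg]

theorem continuous_cosTransform {f : ℝ → ℝ} (hf : Integrable f) : Continuous (cosTransform f) := by
  refine continuous_of_dominated (bound := fun x => ‖f x‖) (fun y => ?_) (fun y => ?_) hf.norm
    (Filter.Eventually.of_forall fun x => by fun_prop)
  · exact (Continuous.aestronglyMeasurable (by fun_prop)).mul hf.aestronglyMeasurable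
  · refine Filter.Eventually.of_forall fun x => ?_
    rw [norm_mul]
    exact mul_le_of_le_one_left (norm_nonneg _) (Real.abs_cos_le_one _)

theorem continuous_phiSol : Continuous (phiSol ε a) := by
  unfold phiSol; fun_prop

theorem phiSol_neg (x : ℝ) : phiSol ε a (-x) = phiSol ε a x := by
  have : (cosCurve a).curry (-x / a) = (cosCurve a).curry (x / a) := by
    ext z
    simp [cosCurve_apply, cosProfile, neg_div]
  rw [phiSol, phiSol, this]
  simp

theorem cosProfile_eq (a x : ℝ) :
    cosProfile a x = a * (2 * Real.cos (2 * Real.pi * a * (a * x))) := by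
  rw [cosProfile, show 2 * Real.pi * a * (a * x) = 2 * Real.pi * a ^ 2 * x by ring]
  ring

theorem mul_phiSol (ha : 0 < a) (hε : ε ^ 2 = 1) (x : I) :
    a * phiSol ε a (a * x) = cosSol ε a x := by
  have h := congrArg (fun g : C(I, ℝ) => g x) (cosSol_add ha hε)
  simp only [ContinuousMap.add_apply, ContinuousMap.smul_apply, smul_eq_mul] at h
  have h2 : integralCLM volume ((cosCurve a).curry (x : ℝ) * cosSol ε a) =
    integralOp volume (cosKernel a) (cosSol ε a) x := rfl
  have h3 : cosVec a x = cosProfile a x := rfl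
  rw [h3, cosProfile_eq] at h
  have h6 : a * (ε * (a⁻¹ * integralOp volume (cosKernel a) (cosSol ε a) x)) =
      ε * integralOp volume (cosKernel a) (cosSol ε a) x := by field_simp
  rw [phiSol, mul_div_cancel_left₀ _ ha.ne', h2, mul_sub, h6]
  linarith

theorem isPhi_phiSol (ha : 0 < a) (hε : ε ^ 2 = 1) : IsPhi ε a (phiSol ε a) := by
  refine ⟨continuous_phiSol.locallyIntegrable, fun x => ?_⟩
  have h := cosTransform_restrictTo ha (phiSol_neg (ε := ε) (a := a)) (x / a)
  rw [mul_div_cancel₀ _ ha.ne'] at h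
  have h2 : ∫ z : I, cosProfile a (x / a * z) * phiSol ε a (a * z) =
      a⁻¹ * integralCLM volume ((cosCurve a).curry (x / a) * cosSol ε a) := by
    rw [integralCLM_apply, ← integral_const_mul]
    refine integral_congr_ae (Filter.Eventually.of_forall fun z => ?_)
    simp only [ContinuousMap.mul_apply, ContinuousMap.curry_apply, cosCurve_apply,
      ← mul_phiSol ha hε z]
    field_simp
  rw [h, h2, phiSol]
  ring

/-- The equation makes a locally integrable solution continuous and even. Then a φ(ax) on [0, 1]
solves the equation of `cosSol`, whose solution is unique, and the equation recovers φ on all of ℝ.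
-/
theorem IsPhi.eq_phiSol (ha : 0 < a) (hε : ε ^ 2 = 1) {φ : ℝ → ℝ} (hφ : IsPhi ε a φ) :
    φ = phiSol ε a := by
  obtain ⟨hloc, heq⟩ := hφ
  have hφ' : ∀ x, φ x = 2 * Real.cos (2 * Real.pi * a * x) -
      ε * cosTransform (restrictTo a φ) x := fun x => by linarith [heq x]
  have hint : Integrable (restrictTo a φ) :=
    (hloc.integrableOn_isCompact isCompact_Icc).integrable_indicator measurableSet_Icc
  have hcont : Continuous φ := by
    rw [funext hφ']
    have := continuous_cosTransform hint
    fun_prop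
  have heven : ∀ x, φ (-x) = φ x := by
    intro x
    rw [hφ', hφ' x, cosTransform_neg]
    simp
  set f : C(I, ℝ) := ⟨fun z => a * φ (a * z), by fun_prop⟩ with hf
  have key : ∀ x, cosTransform (restrictTo a φ) x =
      a⁻¹ * integralCLM volume ((cosCurve a).curry (x / a) * f) := by
    intro x
    have h := cosTransform_restrictTo ha heven (x / a)
    rw [mul_div_cancel₀ _ ha.ne'] at h
    rw [h, integralCLM_apply, ← integral_const_mul]
    refine integral_congr_ae (Filter.Eventually.of_forall fun z => ?_)
    simp only [ContinuousMap.mul_apply, ContinuousMap.curry_apply, cosCurve_apply, hf,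
      ContinuousMap.coe_mk]
    field_simp
  have hfs : f = cosSol ε a := by
    refine eq_cosResolvent ha hε ?_
    ext x
    have h2 : integralCLM volume ((cosCurve a).curry (x : ℝ) * f) =
      integralOp volume (cosKernel a) f x := rfl
    have h3 : cosVec a x = cosProfile a x := rfl
    have h4 := hφ' (a * x)
    rw [key, mul_div_cancel_left₀ _ ha.ne', h2] at h4
    simp only [ContinuousMap.add_apply, ContinuousMap.smul_apply, smul_eq_mul]
    rw [h3, cosProfile_eq]
    have h5 : f x = a * φ (a * x) := rfl
    have h6 : a * (ε * (a⁻¹ * integralOp volume (cosKernel a) f x)) =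
      ε * integralOp volume (cosKernel a) f x := by field_simp
    rw [h5, h4, mul_sub, h6]
    ring
  funext x
  rw [hφ' x, key, hfs, phiSol]

theorem existsUnique_isPhi (ha : 0 < a) (hε : ε ^ 2 = 1) : ∃! φ : ℝ → ℝ, IsPhi ε a φ :=
  ⟨phiSol ε a, isPhi_phiSol ha hε, fun _ hφ => hφ.eq_phiSol ha hε⟩

theorem muPlus_eq {φp φm : ℝ → ℝ → ℝ} (hp : ∀ a : ℝ, 0 < a → IsPhi 1 a (φp a))
    (hm : ∀ a : ℝ, 0 < a → IsPhi (-1) a (φm a)) :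
    muPlus φp φm = fun u => cosSol 1 (Real.exp u) 1 + cosSol (-1) (Real.exp u) 1 := by
  funext u
  have ha := Real.exp_pos u
  have h1 := mul_phiSol (ε := 1) ha (one_pow 2) 1
  have h2 := mul_phiSol (ε := -1) ha (by norm_num) 1
  rw [Set.Icc.coe_one, mul_one] at h1 h2
  rw [muPlus, (hp _ ha).eq_phiSol ha (one_pow 2), (hm _ ha).eq_phiSol ha (by norm_num), h1, h2]

end Phi

end

theorem mainTheorem1 :
    (∀ a : ℝ, 0 < a → (∃! φ : ℝ → ℝ, IsPhi 1 a φ) ∧ (∃! φ : ℝ → ℝ, IsPhi (-1) a φ)) ∧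
    (∀ a : ℝ, 0 < a → 0 < detOneSubD a ∧ 0 < detOneAddF a ∧ 0 < detOneSubF a) ∧
    ContDiff ℝ 2 (fun u : ℝ => Real.log (detOneSubD (Real.exp u))) ∧
    ContDiff ℝ 2 (fun u : ℝ => Real.log (detOneAddF (Real.exp u))) ∧
    ContDiff ℝ 2 (fun u : ℝ => Real.log (detOneSubF (Real.exp u))) ∧
    ∀ φp φm : ℝ → ℝ → ℝ,
      (∀ a : ℝ, 0 < a → IsPhi 1 a (φp a)) →
      (∀ a : ℝ, 0 < a → IsPhi (-1) a (φm a)) →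
      Differentiable ℝ (muPlus φp φm) ∧
      ∀ u : ℝ,
        muPlus φp φm u ^ 2 =
          -iteratedDeriv 2 (fun v : ℝ => Real.log (detOneSubD (Real.exp v))) u ∧
        muPlus φp φm u ^ 2 - deriv (muPlus φp φm) u =
          -2 * iteratedDeriv 2 (fun v : ℝ => Real.log (detOneAddF (Real.exp v))) u ∧
        muPlus φp φm u ^ 2 + deriv (muPlus φp φm) u =
          -2 * iteratedDeriv 2 (fun v : ℝ => Real.log (detOneSubF (Real.exp v))) u := by
  have s1 : (1 : ℝ) ^ 2 = 1 := one_pow 2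
  have s2 : (-1 : ℝ) ^ 2 = 1 := by norm_num
  have p1 := contDiff_cosSol_one s1
  have p2 := contDiff_cosSol_one s2
  simp_rw [detOneSubD_eq, detOneAddF_eq (Real.exp_pos _), detOneSubF_eq (Real.exp_pos _)]
  have pA := pos_of_hasDerivAt_mul (hasDerivAt_det_cosKernel s1) (p1.continuous.const_mul _)
    (tendsto_cosKernel 1)
  have pB := pos_of_hasDerivAt_mul (hasDerivAt_det_cosKernel s2) (p2.continuous.const_mul _)
    (tendsto_cosKernel (-1))
  have pD := pos_of_hasDerivAt_mul hasDerivAt_det_dirichletKernel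
    (p1.continuous.sub p2.continuous) tendsto_dirichletKernel
  have lA := hasDerivAt_log_of_mul (hasDerivAt_det_cosKernel s1) pA
  have lB := hasDerivAt_log_of_mul (hasDerivAt_det_cosKernel s2) pB
  have lD := hasDerivAt_log_of_mul hasDerivAt_det_dirichletKernel pD
  refine ⟨fun a ha => ⟨existsUnique_isPhi ha s1, existsUnique_isPhi ha s2⟩, fun a ha => ?_,
    contDiff_two_of_hasDerivAt lD (p1.sub p2),
    contDiff_two_of_hasDerivAt lA (contDiff_const.mul p1),
    contDiff_two_of_hasDerivAt lB (contDiff_const.mul p2), fun φp φm hp hm => ?_⟩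
  · rw [detOneAddF_eq ha, detOneSubF_eq ha, ← Real.exp_log ha]
    exact ⟨pD _, pA _, pB _⟩
  · rw [muPlus_eq hp hm]
    have d1 := p1.differentiable one_ne_zero
    have d2 := p2.differentiable one_ne_zero
    refine ⟨d1.add d2, fun u => ?_⟩
    -- The logarithmic derivatives are P - Q, P and -Q with P = p(1), Q = q(1), while μ = P + Q. The
    -- relation (P - Q)' = -μ² gives μ² - μ' = -2P' and μ² + μ' = 2Q'.
    have hr := deriv_cosSol_one_sub u
    rw [iteratedDeriv_two_of_hasDerivAt lD, iteratedDeriv_two_of_hasDerivAt lA,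
      iteratedDeriv_two_of_hasDerivAt lB, deriv_const_mul _ (d1 u), deriv_const_mul _ (d2 u),
      deriv_fun_add (d1 u) (d2 u), deriv_fun_sub (d1 u) (d2 u), hr]
    refine ⟨by ring, ?_, ?_⟩ <;> linarith
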